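/- Let $n\ge 2$, let $F$ be a function on $(0,1]$, $x_i=i/n$ and $f=(F(x_1),\ldots,F(x_n))\in\mathbb R^n$. Let $Y$ be a random vector of $\mathbb R^n$ with independent components and $\mathbb E(Y)=f$, and assume that for some positive numbers $\sigma,c$ the noise $\xi=Y-f$ satisfies $$\log\mathbb E\left[e^{\lambda\xi_i}\right]\le \frac{\lambda^2\sigma^2}{2(1-|\lambda|c)},\qquad \forall\lambda\in(-1/c,1/c),\ i=1,\ldots,n$$ (in particular these Laplace transforms are finite). Consider the vectors of $\mathbb R^n$ $$\phi_0=(1/\sqrt n,\ldots,1/\sqrt n),\quad \phi_{2j-1}=\sqrt{2/n}\,\bigl(\cos(2\pi jx_1),\ldots,\cos(2\pi jx_n)\bigr),\quad \phi_{2j}=\sqrt{2/n}\,\bigl(\sin(2\pi jx_1),\ldots,\sin(2\pi jx_n)\bigr)\quad (j\ge 1).$$ Let $\overline D\ge 0$ be an integer and $\mathcal M$ a nonempty family of subsets of $\{0,\ldots,2\overline D\}$. For $m\in\mathcal M$ let $S_m$ be the linear span of the $\phi_j$ with $j\in m$ ($S_\varnothing=\{0\}$), $D_m=\dim S_m$,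 $\Pi_{S_m}$ the orthogonal projector onto $S_m$ and $\hat f_m=\Pi_{S_m}Y$. Let $(\Delta_m)_{m\in\mathcal M}$ be nonnegative numbers, $\Sigma=\sum_{m\in\mathcal M}e^{-\Delta_m}$ and $\kappa=18$. Let $a,b>0$ and assume that $2\overline D+1\le \sqrt n/(a\log n)$. Let $K>1$ and let $\mathrm{pen}:\mathcal M\to\mathbb R_+$ satisfy $$\mathrm{pen}(m)\ge K\kappa^2\left(\sigma^2+\frac{4c(c+\sigma)(b+2)}{a}\right)(D_m+\Delta_m),\qquad\forall m\in\mathcal M.$$ If $\hat m$ is any (measurable) minimizer over $\mathcal M$ of $\mathrm{crit}(m)=|Y-\hat f_m|_2^2+\mathrm{pen}(m)$, then $|f-\hat f_{\hat m}|_2^2$ and the $|f-\hat f_m|_2^2$, $m\in\mathcal M$, are integrable and $$\mathbb E\left[|f-\hat f_{\hat m}|_2^2\right]\le C(K)\left[\inf_{m\in\mathcal M}\left(\mathbb E\left[|f-\hat f_m|_2^2\right]+\mathrm{pen}(m)\right)+R\right],$$ where $$C(K)=\frac{K(K^2+K-1)}{(K-1)^3},\qquad R=\kappa^2\left(\sigma^2+\frac{4c(c+\sigma)(b+2)}{a}\right)\Sigma+\frac{4(b+2)^2(c+\sigma)^2}{a^2(2\overline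 D+1)n^b}.$$ -/

import Mathlib

open MeasureTheory ProbabilityTheory

noncomputable section

namespace TrigSelection

/-- The numerical constant `κ = 18`. -/
def kappa : ℝ := 18

/-- The constant `C(K) = K (K² + K - 1) / (K - 1)³`. -/
def CK (K : ℝ) : ℝ := K * (K ^ 2 + K - 1) / (K - 1) ^ 3

/-- The design points `1/n, 2/n, …, n/n`; the index `i : Fin n` stands for the integer `i + 1`. -/
def designPoint (n : ℕ) (i : Fin n) : ℝ := ((i : ℝ) + 1) / (n : ℝ)

/-- The vector `(F(x₁), …, F(xₙ))`. Only the values of `F` on `(0, 1]` matter. -/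
def regressionMean (n : ℕ) (F : ℝ → ℝ) : EuclideanSpace ℝ (Fin n) :=
  WithLp.toLp 2 fun i => F (designPoint n i)

/-- The discrete trigonometric system: `φ₀` is constant, equal to `1/√n`, and for `k ≥ 1`
`φ_{2k-1} = √(2/n) (cos (2πk xᵢ))ᵢ` and `φ_{2k} = √(2/n) (sin (2πk xᵢ))ᵢ`. -/
def trigSystem (n j : ℕ) : EuclideanSpace ℝ (Fin n) :=
  WithLp.toLp 2 fun i =>
    if j = 0 then 1 / Real.sqrt n
    else if Odd j then
      Real.sqrt (2 / n) * Real.cos (2 * Real.pi * (((j + 1) / 2 : ℕ) : ℝ) * designPoint n i)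
    else
      Real.sqrt (2 / n) * Real.sin (2 * Real.pi * ((j / 2 : ℕ) : ℝ) * designPoint n i)

/-- The model `S_m`, the linear span of the `φ_j` with `j ∈ m` (it is `{0}` for `m = ∅`). -/
def trigModel (n : ℕ) (m : Finset ℕ) : Submodule ℝ (EuclideanSpace ℝ (Fin n)) :=
  Submodule.span ℝ (trigSystem n '' (m : Set ℕ))

/-- The dimension `D_m` of the model `S_m`. -/
def modelDim (n : ℕ) (m : Finset ℕ) : ℕ := Module.finrank ℝ (trigModel n m)

/-- The least-squares estimator `Π_{S_m} y`. -/
def leastSquares (n : ℕ) (m : Finset ℕ) (y : EuclideanSpace ℝ (Fin n)) :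
    EuclideanSpace ℝ (Fin n) :=
  (trigModel n m).starProjection y

/-- The penalized least-squares criterion `|y - Π_{S_m} y|² + pen m`. -/
def crit (n : ℕ) (pen : Finset ℕ → ℝ) (y : EuclideanSpace ℝ (Fin n)) (m : Finset ℕ) : ℝ :=
  ‖y - leastSquares n m y‖ ^ 2 + pen m

/-- The Bernstein-type condition on the log-Laplace transform of `X`; finiteness of the Laplace
transform on `(-1/c, 1/c)` is part of it. -/
def BernsteinCondition {Ω : Type*} [MeasurableSpace Ω] (P : Measure Ω) (X : Ω → ℝ)
    (σ c : ℝ) : Prop :=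
  ∀ t ∈ Set.Ioo (-(1 / c)) (1 / c),
    Integrable (fun ω => Real.exp (t * X ω)) P ∧
      Real.log (∫ ω, Real.exp (t * X ω) ∂P) ≤ t ^ 2 * σ ^ 2 / (2 * (1 - |t| * c))

/-- The factor `σ² + 4c(c+σ)(b+2)/a`. -/
def varianceFactor (σ c a b : ℝ) : ℝ := σ ^ 2 + 4 * c * (c + σ) * (b + 2) / a

/-- The remainder term `R`, where `Σ = ∑_{m ∈ M} exp (-Δ_m)`. -/
def remainder (n Dbar : ℕ) (M : Finset (Finset ℕ)) (Δ : Finset ℕ → ℝ) (σ c a b : ℝ) : ℝ :=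
  kappa ^ 2 * varianceFactor σ c a b * (∑ m ∈ M, Real.exp (-Δ m))
    + 4 * (b + 2) ^ 2 * (c + σ) ^ 2 / (a ^ 2 * (2 * (Dbar : ℝ) + 1) * (n : ℝ) ^ b)

end TrigSelection

end

open MeasureTheory ProbabilityTheory

noncomputable section

namespace TrigSelection

/-! The models are coordinate subspaces of a single orthonormal family. The hypotheses do not force
the frequencies below `n / 2`, so the `φ_j` may be aliased; but any two of them are orthogonal or
proportional, and the nonzero ones have norm at least 1. Normalized representatives `ψ k` therefore
span every model and keep coordinates at most `√(2/n)` (`exists_orthonormal_trigModel`).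

With `β k = ⟪ψ k, f⟫` and `X k = ⟪ψ k, ξ⟫`, the selected risk is the selected criterion, minus its
penalty, plus `2 ∑ β X + 2 ∑ X²` over the selected indices (up to `|Y|² - |f|²`). The cross term is
handled one coordinate at a time: since `X k` is centered, only its covariance with the event "k is
selected" counts. Young's inequality bounds this by a fraction `1/K` of the expected bias plus
`4Kσ²` times the selection probability, which the penalty absorbs (`two_mul_integral_indicator_le`,
`selected_risk_le`).

It remains to dominate `2 ∑ X²` by the penalty in all models at once. Where every `|X k| ≤ z`, the
projected noise has coordinates at most `u`, and a net argument with Chernoff's bound gives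
Gaussian-type tails with variance factor `σ² + uc` (`measure_norm_starProjection_ge_le`,
`integral_excess_le`). Elsewhere, exponential moments make the contribution of order at most the
last term of `R` (`truncation_error_le`). -/

/-! ### Representatives in an orthogonal-or-proportional family. -/

/-- In a family of vectors any two of which are orthogonal or proportional, one can select and
normalize representatives so that the span of every subfamily is spanned by some of them. -/
theorem exists_orthonormal_of_orthogonal_or_proportional {E : Type*} [NormedAddCommGroup E]
    [InnerProductSpace ℝ E] (φ : ℕ → E) (N : ℕ)
    (h : ∀ i j, inner ℝ (φ i) (φ j) = 0 ∨ ∃ r : ℝ, φ i = r • φ j) :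
    ∃ s : Finset ℕ, s ⊆ Finset.range N ∧ (∀ k ∈ s, φ k ≠ 0) ∧
      Orthonormal ℝ (fun k : s => ‖φ k‖⁻¹ • φ k) ∧
      ∀ m ⊆ Finset.range N, ∃ I : Finset s,
        Submodule.span ℝ (φ '' m) = Submodule.span ℝ ((fun k : s => ‖φ k‖⁻¹ • φ k) '' I) := by
  classical
  -- Keep an index when its vector is nonzero and orthogonal to all earlier ones: one index per
  -- line.
  set s : Finset ℕ := {j ∈ Finset.range N | φ j ≠ 0 ∧ ∀ i < j, inner ℝ (φ i) (φ j) = 0} with hs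
  have hmem : ∀ k ∈ s, k < N ∧ φ k ≠ 0 ∧ ∀ i < k, inner ℝ (φ i) (φ k) = 0 := by
    intro k hk; simpa [hs] using hk
  refine ⟨s, Finset.filter_subset _ _, fun k hk => (hmem k hk).2.1, ⟨?_, ?_⟩, ?_⟩
  · rintro ⟨k, hk⟩
    have := (hmem k hk).2.1
    rw [norm_smul, norm_inv, norm_norm, inv_mul_cancel₀ (norm_ne_zero_iff.2 this)]
  · rintro ⟨k, hk⟩ ⟨l, hl⟩ hkl
    have hkl' : k ≠ l := fun h => hkl (Subtype.ext h)
    have : inner ℝ (φ k) (φ l) = 0 := by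
      rcases lt_or_gt_of_ne hkl' with h1 | h1
      · exact (hmem l hl).2.2 k h1
      · rw [real_inner_comm]; exact (hmem k hk).2.2 l h1
    simp [inner_smul_left, inner_smul_right, this]
  · intro m hm
    -- every nonzero vector of the family is proportional to a representative
    have key : ∀ j ∈ m, φ j ≠ 0 → ∃ k : s, ∃ r : ℝ, r ≠ 0 ∧ φ k = r • φ j := by
      intro j hj hj0
      -- The representative is the first vector not orthogonal to `φ j`; being proportional to `φ
      -- j`, it inherits orthogonality to everything earlier.
      have hex : ∃ i, inner ℝ (φ i) (φ j) ≠ 0 := ⟨j, by simpa using hj0⟩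
      have hi := Nat.find_spec hex
      have hmin := fun i' (h' : i' < Nat.find hex) => not_not.1 (Nat.find_min hex h')
      have hle : Nat.find hex ≤ j := Nat.find_min' hex (by simpa using hj0)
      set i := Nat.find hex
      obtain ⟨r, hr⟩ := (h i j).resolve_left hi
      have hr0 : r ≠ 0 := by
        rintro rfl
        apply hi; simp [hr]
      have hjN : j < N := Finset.mem_range.1 (hm hj)
      refine ⟨⟨i, ?_⟩, r, hr0, hr⟩
      simp only [hs, Finset.mem_filter, Finset.mem_range]
      refine ⟨by omega, ?_, fun i' h' => ?_⟩
      · rw [hr]; exact smul_ne_zero hr0 hj0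
      · rw [hr, inner_smul_right, hmin i' h', mul_zero]
    refine ⟨Finset.univ.filter (fun k : s => ∃ j ∈ m, ∃ r : ℝ, φ k = r • φ j), ?_⟩
    apply le_antisymm
    · rw [Submodule.span_le]
      rintro _ ⟨j, hj, rfl⟩
      by_cases hj0 : φ j = 0
      · rw [hj0]; exact Submodule.zero_mem _
      obtain ⟨k, r, hr0, hk⟩ := key j hj hj0
      have hk0 : ‖φ k‖ ≠ 0 := norm_ne_zero_iff.2 (by rw [hk]; exact smul_ne_zero hr0 hj0)
      have : φ j = (r⁻¹ * ‖φ k‖) • (‖φ k‖⁻¹ • φ k) := by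
        rw [smul_smul, mul_assoc, mul_inv_cancel₀ hk0, mul_one, hk, smul_smul,
          inv_mul_cancel₀ hr0, one_smul]
      rw [this]
      refine Submodule.smul_mem _ _ (Submodule.subset_span ⟨k, ?_, rfl⟩)
      simp only [Finset.coe_filter, Finset.mem_univ, true_and, Set.mem_ofPred_eq]
      exact ⟨j, hj, r, hk⟩
    · rw [Submodule.span_le]
      rintro _ ⟨k, hk, rfl⟩
      simp only [Finset.coe_filter, Finset.mem_univ, true_and, Set.mem_ofPred_eq] at hk
      obtain ⟨j, hj, r, hk⟩ := hk
      refine Submodule.smul_mem _ _ ?_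
      rw [hk]
      exact Submodule.smul_mem _ _ (Submodule.subset_span ⟨j, hj, rfl⟩)

/-! ### Discrete trigonometric sums and aliasing. -/

/-- A geometric sum in the `n`-th root of unity `w = exp(2πi p/n)`, which is 1 exactly when `n ∣ p`.
Design points start at `1/n`, hence the extra factor `w`. -/
theorem sum_exp_designPoint {n : ℕ} (hn : n ≠ 0) (p : ℤ) :
    ∑ i : Fin n, Complex.exp ((2 * Real.pi * p * designPoint n i : ℝ) * Complex.I)
      = if (n : ℤ) ∣ p then (n : ℂ) else 0 := by
  have hn' : (n : ℂ) ≠ 0 := Nat.cast_ne_zero.2 hn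
  set w : ℂ := Complex.exp (2 * Real.pi * Complex.I * (p / n)) with hw
  have hterm : ∀ i : Fin n, Complex.exp ((2 * Real.pi * p * designPoint n i : ℝ) * Complex.I)
      = w ^ (i : ℕ) * w := by
    intro i
    rw [← pow_succ, hw, ← Complex.exp_nat_mul]
    congr 1
    simp only [designPoint]
    push_cast
    field_simp
  simp_rw [hterm]
  rw [← Finset.sum_mul, Fin.sum_univ_eq_sum_range (fun i => w ^ i)]
  split_ifs with hd
  · obtain ⟨q, rfl⟩ := hd
    have : w = 1 := by
      rw [hw, Complex.exp_eq_one_iff]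
      refine ⟨q, ?_⟩
      push_cast
      field_simp
    simp [this]
  · have hw1 : w ≠ 1 := by
      intro h1
      rw [hw, Complex.exp_eq_one_iff] at h1
      obtain ⟨q, hq⟩ := h1
      apply hd
      refine ⟨q, ?_⟩
      have hpi : (2 * Real.pi * Complex.I : ℂ) ≠ 0 := Complex.two_pi_I_ne_zero
      have h2 : (p : ℂ) / n = q := by
        apply mul_left_cancel₀ hpi
        rw [hq]; ring
      rw [div_eq_iff hn'] at h2
      have : (p : ℂ) = ((n : ℤ) * q : ℤ) := by rw [h2]; push_cast; ring
      exact_mod_cast this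
    have hwn : w ^ n = 1 := by
      rw [hw, ← Complex.exp_nat_mul, Complex.exp_eq_one_iff]
      exact ⟨p, by field_simp⟩
    rw [geom_sum_eq hw1, hwn, sub_self, zero_div, zero_mul]

theorem sum_cos_designPoint {n : ℕ} (hn : n ≠ 0) (p : ℤ) :
    ∑ i : Fin n, Real.cos (2 * Real.pi * p * designPoint n i)
      = if (n : ℤ) ∣ p then (n : ℝ) else 0 := by
  have h := congrArg Complex.re (sum_exp_designPoint hn p)
  rw [Complex.re_sum] at h
  simp only [Complex.exp_ofReal_mul_I_re] at h
  rw [h]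
  split_ifs <;> simp

theorem sum_sin_designPoint {n : ℕ} (hn : n ≠ 0) (p : ℤ) :
    ∑ i : Fin n, Real.sin (2 * Real.pi * p * designPoint n i) = 0 := by
  have h := congrArg Complex.im (sum_exp_designPoint hn p)
  rw [Complex.im_sum] at h
  simp only [Complex.exp_ofReal_mul_I_im] at h
  rw [h]
  split_ifs <;> simp

/-- The vector `√(2/n) (cos (2πp xᵢ))ᵢ`. -/
def cosVec (n p : ℕ) : EuclideanSpace ℝ (Fin n) :=
  WithLp.toLp 2 fun i => Real.sqrt (2 / n) * Real.cos (2 * Real.pi * (p : ℝ) * designPoint n i)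

/-- The vector `√(2/n) (sin (2πp xᵢ))ᵢ`. -/
def sinVec (n p : ℕ) : EuclideanSpace ℝ (Fin n) :=
  WithLp.toLp 2 fun i => Real.sqrt (2 / n) * Real.sin (2 * Real.pi * (p : ℝ) * designPoint n i)

/-- Treats `φ₀` as a multiple of the cosine vector of frequency 0. The value of `r` is recorded
because the lower bound on norms depends on it. -/
theorem trigSystem_eq (n j : ℕ) :
    (∃ p, ∃ r : ℝ, r ≠ 0 ∧ (r = 1 ∨ p = 0 ∧ r = √(1 / 2)) ∧ trigSystem n j = r • cosVec n p) ∨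
      ∃ p, trigSystem n j = sinVec n p := by
  rcases eq_or_ne j 0 with rfl | hj
  · refine Or.inl ⟨0, √(1 / 2), by positivity, Or.inr ⟨rfl, rfl⟩, ?_⟩
    ext i
    simp only [trigSystem, cosVec, if_true, PiLp.smul_apply, smul_eq_mul, Nat.cast_zero, mul_zero,
      zero_mul, Real.cos_zero, mul_one]
    rw [← Real.sqrt_mul (by norm_num), one_div, ← Real.sqrt_inv]
    congr 1
    ring
  · by_cases ho : Odd j
    · refine Or.inl ⟨(j + 1) / 2, 1, one_ne_zero, Or.inl rfl, ?_⟩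
      ext i
      simp [trigSystem, cosVec, hj, ho]
    · refine Or.inr ⟨j / 2, ?_⟩
      ext i
      simp [trigSystem, sinVec, hj, ho]

/-- Product-to-sum formulas. Both divisibilities can hold, for instance when `p = q` and `n ∣ 2p`;
the squared norm is then 2. -/
theorem inner_cosVec_cosVec {n : ℕ} (hn : n ≠ 0) (p q : ℕ) :
    inner ℝ (cosVec n p) (cosVec n q)
      = (if (n : ℤ) ∣ (p : ℤ) - q then 1 else 0) + (if (n : ℤ) ∣ (p : ℤ) + q then 1 else 0) := by
  have hn' : (n : ℝ) ≠ 0 := Nat.cast_ne_zero.2 hn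
  have h : inner ℝ (cosVec n p) (cosVec n q) =
      (1 / n : ℝ) * (∑ i : Fin n, Real.cos (2 * Real.pi * ((p - q : ℤ) : ℝ) * designPoint n i)
        + ∑ i : Fin n, Real.cos (2 * Real.pi * ((p + q : ℤ) : ℝ) * designPoint n i)) := by
    rw [← Finset.sum_add_distrib, Finset.mul_sum, PiLp.inner_apply]
    refine Finset.sum_congr rfl fun i _ => ?_
    have e1 : 2 * Real.pi * ((p - q : ℤ) : ℝ) * designPoint n i
        = 2 * Real.pi * p * designPoint n i - 2 * Real.pi * q * designPoint n i := by
      push_cast; ring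
    have e2 : 2 * Real.pi * ((p + q : ℤ) : ℝ) * designPoint n i
        = 2 * Real.pi * p * designPoint n i + 2 * Real.pi * q * designPoint n i := by
      push_cast; ring
    have hsq : √(2 / n : ℝ) * √(2 / n) = 2 / n := Real.mul_self_sqrt (by positivity)
    rw [e1, e2, Real.cos_add, Real.cos_sub]
    simp only [cosVec, RCLike.inner_apply, conj_trivial]
    linear_combination (Real.cos (2 * Real.pi * p * designPoint n i)
      * Real.cos (2 * Real.pi * q * designPoint n i)) * hsq
  rw [h, sum_cos_designPoint hn, sum_cos_designPoint hn]
  split_ifs <;> field_simp <;> norm_num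

theorem inner_sinVec_sinVec {n : ℕ} (hn : n ≠ 0) (p q : ℕ) :
    inner ℝ (sinVec n p) (sinVec n q)
      = (if (n : ℤ) ∣ (p : ℤ) - q then 1 else 0) - (if (n : ℤ) ∣ (p : ℤ) + q then 1 else 0) := by
  have hn' : (n : ℝ) ≠ 0 := Nat.cast_ne_zero.2 hn
  have h : inner ℝ (sinVec n p) (sinVec n q) =
      (1 / n : ℝ) * (∑ i : Fin n, Real.cos (2 * Real.pi * ((p - q : ℤ) : ℝ) * designPoint n i)
        - ∑ i : Fin n, Real.cos (2 * Real.pi * ((p + q : ℤ) : ℝ) * designPoint n i)) := by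
    rw [← Finset.sum_sub_distrib, Finset.mul_sum, PiLp.inner_apply]
    refine Finset.sum_congr rfl fun i _ => ?_
    have e1 : 2 * Real.pi * ((p - q : ℤ) : ℝ) * designPoint n i
        = 2 * Real.pi * p * designPoint n i - 2 * Real.pi * q * designPoint n i := by
      push_cast; ring
    have e2 : 2 * Real.pi * ((p + q : ℤ) : ℝ) * designPoint n i
        = 2 * Real.pi * p * designPoint n i + 2 * Real.pi * q * designPoint n i := by
      push_cast; ring
    have hsq : √(2 / n : ℝ) * √(2 / n) = 2 / n := Real.mul_self_sqrt (by positivity)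
    rw [e1, e2, Real.cos_add, Real.cos_sub]
    simp only [sinVec, RCLike.inner_apply, conj_trivial]
    linear_combination (Real.sin (2 * Real.pi * p * designPoint n i)
      * Real.sin (2 * Real.pi * q * designPoint n i)) * hsq
  rw [h, sum_cos_designPoint hn, sum_cos_designPoint hn]
  split_ifs <;> field_simp <;> norm_num

theorem inner_cosVec_sinVec {n : ℕ} (hn : n ≠ 0) (p q : ℕ) :
    inner ℝ (cosVec n p) (sinVec n q) = 0 := by
  have h : inner ℝ (cosVec n p) (sinVec n q) =
      (1 / n : ℝ) * (∑ i : Fin n, Real.sin (2 * Real.pi * ((p + q : ℤ) : ℝ) * designPoint n i)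
        - ∑ i : Fin n, Real.sin (2 * Real.pi * ((p - q : ℤ) : ℝ) * designPoint n i)) := by
    rw [← Finset.sum_sub_distrib, Finset.mul_sum, PiLp.inner_apply]
    refine Finset.sum_congr rfl fun i _ => ?_
    have e1 : 2 * Real.pi * ((p - q : ℤ) : ℝ) * designPoint n i
        = 2 * Real.pi * p * designPoint n i - 2 * Real.pi * q * designPoint n i := by
      push_cast; ring
    have e2 : 2 * Real.pi * ((p + q : ℤ) : ℝ) * designPoint n i
        = 2 * Real.pi * p * designPoint n i + 2 * Real.pi * q * designPoint n i := by
      push_cast; ring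
    have hsq : √(2 / n : ℝ) * √(2 / n) = 2 / n := Real.mul_self_sqrt (by positivity)
    rw [e1, e2, Real.sin_add, Real.sin_sub]
    simp only [sinVec, cosVec, RCLike.inner_apply, conj_trivial]
    linear_combination (Real.cos (2 * Real.pi * p * designPoint n i)
      * Real.sin (2 * Real.pi * q * designPoint n i)) * hsq
  rw [h, sum_sin_designPoint hn, sum_sin_designPoint hn]
  simp

/-- Frequencies that agree modulo `n` are aliased on the design. -/
theorem exists_two_pi_mul_designPoint {n : ℕ} (hn : n ≠ 0) {p : ℤ} (h : (n : ℤ) ∣ p) (i : Fin n) :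
    ∃ k : ℤ, 2 * Real.pi * p * designPoint n i = k * (2 * Real.pi) := by
  have hn' : (n : ℝ) ≠ 0 := Nat.cast_ne_zero.2 hn
  obtain ⟨q, rfl⟩ := h
  refine ⟨q * (i + 1), ?_⟩
  simp only [designPoint]
  push_cast
  field_simp

theorem cosVec_eq_of_dvd_sub {n : ℕ} (hn : n ≠ 0) {p q : ℕ} (h : (n : ℤ) ∣ (p : ℤ) - q) :
    cosVec n p = cosVec n q ∧ sinVec n p = sinVec n q := by
  have key : ∀ i : Fin n, ∃ k : ℤ, 2 * Real.pi * p * designPoint n i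
      = 2 * Real.pi * q * designPoint n i + k * (2 * Real.pi) := by
    intro i
    obtain ⟨k, hk⟩ := exists_two_pi_mul_designPoint hn h i
    exact ⟨k, by rw [← hk]; push_cast; ring⟩
  constructor
  · ext i
    obtain ⟨k, hk⟩ := key i
    simp only [cosVec, hk, Real.cos_add_int_mul_two_pi]
  · ext i
    obtain ⟨k, hk⟩ := key i
    simp only [sinVec, hk, Real.sin_add_int_mul_two_pi]

theorem cosVec_eq_of_dvd_add {n : ℕ} (hn : n ≠ 0) {p q : ℕ} (h : (n : ℤ) ∣ (p : ℤ) + q) :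
    cosVec n p = cosVec n q ∧ sinVec n p = -sinVec n q := by
  have key : ∀ i : Fin n, ∃ k : ℤ, 2 * Real.pi * p * designPoint n i
      = -(2 * Real.pi * q * designPoint n i) + k * (2 * Real.pi) := by
    intro i
    obtain ⟨k, hk⟩ := exists_two_pi_mul_designPoint hn h i
    exact ⟨k, by rw [← hk]; push_cast; ring⟩
  constructor
  · ext i
    obtain ⟨k, hk⟩ := key i
    simp only [cosVec, hk, Real.cos_add_int_mul_two_pi, Real.cos_neg]
  · ext i
    obtain ⟨k, hk⟩ := key i
    simp only [sinVec, hk, Real.sin_add_int_mul_two_pi, Real.sin_neg, PiLp.neg_apply, mul_neg]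

theorem cosVec_orthogonal_or_eq {n : ℕ} (hn : n ≠ 0) (p q : ℕ) :
    inner ℝ (cosVec n p) (cosVec n q) = 0 ∨ cosVec n p = cosVec n q := by
  by_cases h1 : (n : ℤ) ∣ (p : ℤ) - q
  · exact Or.inr (cosVec_eq_of_dvd_sub hn h1).1
  by_cases h2 : (n : ℤ) ∣ (p : ℤ) + q
  · exact Or.inr (cosVec_eq_of_dvd_add hn h2).1
  · left; rw [inner_cosVec_cosVec hn, if_neg h1, if_neg h2, add_zero]

theorem sinVec_orthogonal_or_proportional {n : ℕ} (hn : n ≠ 0) (p q : ℕ) :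
    inner ℝ (sinVec n p) (sinVec n q) = 0 ∨ ∃ r : ℝ, sinVec n p = r • sinVec n q := by
  by_cases h1 : (n : ℤ) ∣ (p : ℤ) - q
  · exact Or.inr ⟨1, by rw [one_smul]; exact (cosVec_eq_of_dvd_sub hn h1).2⟩
  by_cases h2 : (n : ℤ) ∣ (p : ℤ) + q
  · exact Or.inr ⟨-1, by rw [neg_one_smul]; exact (cosVec_eq_of_dvd_add hn h2).2⟩
  · left; rw [inner_sinVec_sinVec hn, if_neg h1, if_neg h2, sub_zero]

theorem trigSystem_orthogonal_or_proportional {n : ℕ} (hn : n ≠ 0) (i j : ℕ) :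
    inner ℝ (trigSystem n i) (trigSystem n j) = 0 ∨
      ∃ r : ℝ, trigSystem n i = r • trigSystem n j := by
  rcases trigSystem_eq n i with ⟨p, r, hr, -, hi⟩ | ⟨p, hi⟩ <;>
    rcases trigSystem_eq n j with ⟨q, t, ht, -, hj⟩ | ⟨q, hj⟩ <;> rw [hi, hj]
  · rcases cosVec_orthogonal_or_eq hn p q with h | h
    · left; rw [inner_smul_left, inner_smul_right, h]; simp
    · right
      refine ⟨r * t⁻¹, ?_⟩
      rw [smul_smul, mul_assoc, inv_mul_cancel₀ ht, mul_one, h]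
  · left; rw [inner_smul_left, inner_cosVec_sinVec hn, mul_zero]
  · left; rw [inner_smul_right, real_inner_comm, inner_cosVec_sinVec hn, mul_zero]
  · exact sinVec_orthogonal_or_proportional hn p q

/-- Squared norms are 1 or 2 for cosines, 0 or 1 for sines, and `1/2 * 2` for `φ₀`. Normalizing thus
never enlarges coordinates. -/
theorem one_le_norm_trigSystem {n : ℕ} (hn : n ≠ 0) {j : ℕ} (hj : trigSystem n j ≠ 0) :
    1 ≤ ‖trigSystem n j‖ := by
  rw [← one_le_sq_iff₀ (norm_nonneg _), ← real_inner_self_eq_norm_sq]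
  rcases trigSystem_eq n j with ⟨p, r, hr, hr', h⟩ | ⟨p, h⟩
  · rw [h, inner_smul_left, inner_smul_right, inner_cosVec_cosVec hn]
    rcases hr' with rfl | ⟨rfl, rfl⟩
    · simp only [sub_self, dvd_zero, if_true, conj_trivial, one_mul]
      split_ifs <;> norm_num
    · simp only [Nat.cast_zero, sub_self, add_zero, dvd_zero, if_true, conj_trivial]
      rw [← mul_assoc, Real.mul_self_sqrt (by norm_num)]
      norm_num
  · have h0 : inner ℝ (trigSystem n j) (trigSystem n j) ≠ 0 := by simpa using hj
    rw [h, inner_sinVec_sinVec hn] at h0 ⊢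
    simp only [sub_self, dvd_zero, if_true] at h0 ⊢
    split_ifs at h0 ⊢ <;> simp at h0 ⊢

theorem abs_trigSystem_apply_le (n j : ℕ) (i : Fin n) : |trigSystem n j i| ≤ √(2 / n) := by
  have key : ∀ x : ℝ, |x| ≤ 1 → |√(2 / n : ℝ) * x| ≤ √(2 / n) := by
    intro x hx
    rw [abs_mul, abs_of_nonneg (Real.sqrt_nonneg _)]
    exact mul_le_of_le_one_right (Real.sqrt_nonneg _) hx
  simp only [trigSystem]
  split_ifs
  · rw [abs_of_nonneg (by positivity), one_div, ← Real.sqrt_inv, ← one_div]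
    gcongr; norm_num
  · exact key _ (Real.abs_cos_le_one _)
  · exact key _ (Real.abs_sin_le_one _)

/-- The models spanned by trigonometric vectors are spanned by subfamilies of one orthonormal
family with small coordinates. -/
theorem exists_orthonormal_trigModel {n : ℕ} (hn : n ≠ 0) (N : ℕ) :
    ∃ (s : Finset ℕ) (ψ : s → EuclideanSpace ℝ (Fin n)), s.card ≤ N ∧ Orthonormal ℝ ψ ∧
      (∀ k i, |ψ k i| ≤ √(2 / n)) ∧
      ∀ m ⊆ Finset.range N, ∃ I : Finset s, trigModel n m = Submodule.span ℝ (ψ '' I) := by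
  obtain ⟨s, hsN, hs0, hψ, hI⟩ := exists_orthonormal_of_orthogonal_or_proportional
    (trigSystem n) N (trigSystem_orthogonal_or_proportional hn)
  refine ⟨s, _, by simpa using Finset.card_le_card hsN, hψ, fun k i => ?_, hI⟩
  have h1 := one_le_norm_trigSystem hn (hs0 k k.2)
  rw [PiLp.smul_apply, smul_eq_mul, abs_mul, abs_inv, abs_norm]
  exact (mul_le_of_le_one_left (abs_nonneg _) (inv_le_one_of_one_le₀ h1)).trans
    (abs_trigSystem_apply_le n k i)

/-! ### Exponential moments of linear forms in the noise. -/

theorem one_add_sq_div_two_le_cosh (x : ℝ) : 1 + x ^ 2 / 2 ≤ Real.cosh x := by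
  have h1 : |x| / 2 ≤ Real.sinh (|x| / 2) := Real.self_le_sinh_iff.2 (by positivity)
  have h2 : Real.cosh x = 1 + 2 * Real.sinh (|x| / 2) ^ 2 := by
    rw [← Real.cosh_abs, show |x| = 2 * (|x| / 2) by ring, Real.cosh_two_mul, Real.cosh_sq]
    ring_nf
  have h3 : (|x| / 2) ^ 2 ≤ Real.sinh (|x| / 2) ^ 2 := by gcongr
  rw [h2]
  rw [div_pow, sq_abs] at h3
  linarith

/-- Sub-exponential control of the linear forms in `ξ` with small coefficients. -/
def LaplaceBound {Ω : Type*} [MeasurableSpace Ω] {n : ℕ} (P : Measure Ω)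
    (ξ : Ω → EuclideanSpace ℝ (Fin n)) (σ c : ℝ) : Prop :=
  ∀ t : EuclideanSpace ℝ (Fin n), (∀ i, |t i| * c ≤ 1 / 2) →
    Integrable (fun ω => Real.exp (inner ℝ t (ξ ω))) P ∧
      ∫ ω, Real.exp (inner ℝ t (ξ ω)) ∂P ≤ Real.exp (σ ^ 2 * ‖t‖ ^ 2)

section LaplaceBound

variable {Ω : Type*} [MeasurableSpace Ω] {P : Measure Ω} {n : ℕ}
  {ξ : Ω → EuclideanSpace ℝ (Fin n)} {σ c : ℝ}

theorem BernsteinCondition.laplace [IsProbabilityMeasure P] {X : Ω → ℝ}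
    (h : BernsteinCondition P X σ c) (hc : 0 < c)
    {t : ℝ} (ht : |t| * c ≤ 1 / 2) :
    Integrable (fun ω => Real.exp (t * X ω)) P ∧
      ∫ ω, Real.exp (t * X ω) ∂P ≤ Real.exp (σ ^ 2 * t ^ 2) := by
  have hlt : |t| < 1 / c := by rw [lt_div_iff₀ hc]; linarith
  obtain ⟨hi, hl⟩ := h t (by rw [Set.mem_Ioo]; exact abs_lt.1 hlt)
  refine ⟨hi, ?_⟩
  rw [← Real.log_le_iff_le_exp (integral_exp_pos hi)]
  refine hl.trans ?_
  -- The restriction `|t| c ≤ 1/2` makes the denominator `2(1 - |t|c)` at least 1.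
  rw [div_le_iff₀ (by linarith)]
  have : 0 ≤ t ^ 2 * σ ^ 2 := by positivity
  nlinarith

theorem laplaceBound_of_bernstein [IsProbabilityMeasure P] (hξ : Measurable ξ) (hc : 0 < c)
    (hindep : iIndepFun (fun (i : Fin n) (ω : Ω) => ξ ω i) P)
    (hb : ∀ i : Fin n, BernsteinCondition P (fun ω => ξ ω i) σ c) : LaplaceBound P ξ σ c := by
  intro t ht
  have hm : ∀ i, Measurable fun ω => ξ ω i := fun i => by fun_prop
  have hind : iIndepFun (fun (i : Fin n) (ω : Ω) => t i * ξ ω i) P :=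
    hindep.comp (fun i x => t i * x) (fun i => by fun_prop)
  have hm' : ∀ i, Measurable fun ω => t i * ξ ω i := fun i => by fun_prop
  have heq : ∀ ω, Real.exp (inner ℝ t (ξ ω))
      = Real.exp (1 * (∑ i : Fin n, fun ω => t i * ξ ω i) ω) := by
    intro ω
    rw [one_mul, Finset.sum_apply, PiLp.inner_apply]
    congr 1
    refine Finset.sum_congr rfl fun i _ => ?_
    simp [mul_comm]
  simp_rw [heq]
  constructor
  · refine hind.integrable_exp_mul_sum hm' fun i _ => ?_
    simpa using ((hb i).laplace hc (ht i)).1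
  · have h1 := hind.mgf_sum (t := 1) hm' Finset.univ
    rw [mgf] at h1
    rw [h1, EuclideanSpace.norm_sq_eq, Finset.mul_sum, Real.exp_sum]
    refine Finset.prod_le_prod (fun i _ => mgf_nonneg) fun i _ => ?_
    have := ((hb i).laplace hc (ht i)).2
    simpa [mgf] using this

/-- A unit vector has coordinates at most 1, so `t • ψ` is an admissible coefficient vector. -/
theorem LaplaceBound.integrable_exp_unit (h : LaplaceBound P ξ σ c) (hc : 0 < c)
    {ψ : EuclideanSpace ℝ (Fin n)} (hψ : ‖ψ‖ = 1) {t : ℝ} (ht : |t| * c ≤ 1 / 2) :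
    Integrable (fun ω => Real.exp (t * inner ℝ ψ (ξ ω))) P ∧
      ∫ ω, Real.exp (t * inner ℝ ψ (ξ ω)) ∂P ≤ Real.exp (σ ^ 2 * t ^ 2) := by
  have h1 := h (t • ψ) (fun i => by
    rw [PiLp.smul_apply, smul_eq_mul, abs_mul]
    have h2 : |ψ i| ≤ 1 := by simpa [hψ] using PiLp.norm_apply_le ψ i
    have h3 : |t| * |ψ i| ≤ |t| := mul_le_of_le_one_right (abs_nonneg _) h2
    exact (mul_le_mul_of_nonneg_right h3 hc.le).trans ht)
  simpa [inner_smul_left, norm_smul, hψ] using h1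

theorem LaplaceBound.integrable_sq [IsProbabilityMeasure P] (h : LaplaceBound P ξ σ c)
    (hξ : Measurable ξ) (hc : 0 < c)
    (hσ : 0 < σ) {ψ : EuclideanSpace ℝ (Fin n)} (hψ : ‖ψ‖ = 1) :
    Integrable (fun ω => (inner ℝ ψ (ξ ω)) ^ 2) P ∧ ∫ ω, (inner ℝ ψ (ξ ω)) ^ 2 ∂P ≤ 4 * σ ^ 2 := by
  set t : ℝ := 1 / (2 * (c + σ)) with ht
  have ht0 : 0 < t := by positivity
  have htc : |t| * c ≤ 1 / 2 := by
    rw [abs_of_pos ht0, ht, div_mul_eq_mul_div, div_le_div_iff₀ (by positivity) (by norm_num)]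
    linarith
  have htσ : t * σ ≤ 1 := by
    rw [ht, div_mul_eq_mul_div, div_le_one (by positivity)]
    linarith
  obtain ⟨hi1, hb1⟩ := h.integrable_exp_unit hc hψ htc
  obtain ⟨hi2, hb2⟩ := h.integrable_exp_unit hc hψ (t := -t) (by rwa [abs_neg])
  -- The square is dominated by `2 cosh(tx) - 2`, whose mean is at most `2(exp(σ²t²) - 1)`, of order
  -- `t²σ²`.
  have hpt : ∀ x : ℝ, t ^ 2 * x ^ 2 ≤ Real.exp (t * x) + Real.exp (-t * x) - 2 := by
    intro x
    have h1 := one_add_sq_div_two_le_cosh (t * x)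
    rw [Real.cosh_eq, ← neg_mul] at h1
    nlinarith
  have hI : Integrable (fun ω => t ^ 2 * (inner ℝ ψ (ξ ω)) ^ 2) P := by
    refine ((hi1.add hi2).sub (integrable_const 2)).mono' (by fun_prop) ?_
    refine Filter.Eventually.of_forall fun ω => ?_
    rw [Real.norm_of_nonneg (by positivity)]
    exact hpt _
  have hI' : Integrable (fun ω => (inner ℝ ψ (ξ ω)) ^ 2) P := by
    refine (hI.const_mul (t ^ 2)⁻¹).congr (Filter.Eventually.of_forall fun ω => ?_)
    simp only
    field_simp
  refine ⟨hI', ?_⟩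
  have h2 : t ^ 2 * ∫ ω, (inner ℝ ψ (ξ ω)) ^ 2 ∂P ≤ t ^ 2 * (4 * σ ^ 2) := by
    rw [← integral_const_mul]
    calc ∫ ω, t ^ 2 * (inner ℝ ψ (ξ ω)) ^ 2 ∂P
        ≤ ∫ ω, (Real.exp (t * inner ℝ ψ (ξ ω)) + Real.exp (-t * inner ℝ ψ (ξ ω)) - 2) ∂P :=
          integral_mono hI ((hi1.add hi2).sub (integrable_const 2)) fun ω => hpt _
      _ = (∫ ω, Real.exp (t * inner ℝ ψ (ξ ω)) ∂P) + (∫ ω, Real.exp (-t * inner ℝ ψ (ξ ω)) ∂P)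
            - 2 := by
          rw [← integral_add hi1 hi2, integral_sub _ (integrable_const 2)]
          · simp
          · exact hi1.add hi2
      _ ≤ 2 * (Real.exp (σ ^ 2 * t ^ 2) - 1) := by
          rw [neg_sq] at hb2
          linarith
      _ ≤ t ^ 2 * (4 * σ ^ 2) := by
          have h3 : σ ^ 2 * t ^ 2 ≤ 1 := by
            rw [← mul_pow, mul_comm]; exact pow_le_one₀ (by positivity) htσ
          have h4 := Real.abs_exp_sub_one_le (x := σ ^ 2 * t ^ 2)
            (by rwa [abs_of_nonneg (by positivity)])
          rw [abs_of_nonneg (a := σ ^ 2 * t ^ 2) (by positivity)] at h4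
          have h5 := (le_abs_self _).trans h4
          nlinarith
  exact le_of_mul_le_mul_left h2 (by positivity)

theorem LaplaceBound.integral_sq_indicator_le [IsProbabilityMeasure P]
    (h : LaplaceBound P ξ σ c) (hξ : Measurable ξ)
    (hc : 0 < c) (hσ : 0 < σ) {ψ : EuclideanSpace ℝ (Fin n)} (hψ : ‖ψ‖ = 1) (z : ℝ) :
    ∫ ω, {ω | z < |inner ℝ ψ (ξ ω)|}.indicator (fun ω => (inner ℝ ψ (ξ ω)) ^ 2) ω ∂P
      ≤ 100 * (c + σ) ^ 2 * Real.exp (-(z / (4 * (c + σ)))) := by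
  set t : ℝ := 1 / (2 * (c + σ)) with ht
  have ht0 : 0 < t := by positivity
  have htc : |t| * c ≤ 1 / 2 := by
    rw [abs_of_pos ht0, ht, div_mul_eq_mul_div, div_le_div_iff₀ (by positivity) (by norm_num)]
    linarith
  have htσ : t * σ ≤ 1 / 2 := by
    rw [ht, div_mul_eq_mul_div, div_le_div_iff₀ (by positivity) (by norm_num)]
    linarith
  obtain ⟨hi1, hb1⟩ := h.integrable_exp_unit hc hψ htc
  obtain ⟨hi2, hb2⟩ := h.integrable_exp_unit hc hψ (t := -t) (by rwa [abs_neg])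
  -- Half of the exponent `t|x|` pays for the square, the other half yields the decay in `z`.
  have hpt : ∀ x : ℝ, z < |x| → x ^ 2 ≤ (8 / t ^ 2 * Real.exp (-(t * z / 2))) *
      (Real.exp (t * x) + Real.exp (-t * x)) := by
    intro x hx
    have h1 : Real.exp (t * |x|) ≤ Real.exp (t * x) + Real.exp (-t * x) := by
      rcases abs_choice x with h1 | h1 <;> rw [h1]
      · linarith [Real.exp_pos (-t * x)]
      · rw [mul_neg, ← neg_mul]; linarith [Real.exp_pos (t * x)]
    have h2 : (t * |x| / 2) ^ 2 / 2 ≤ Real.exp (t * |x| / 2) := by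
      have := Real.quadratic_le_exp_of_nonneg (x := t * |x| / 2) (by positivity)
      have h0 : 0 ≤ t * |x| / 2 := by positivity
      linarith
    have h3 : Real.exp (t * |x| / 2) ≤ Real.exp (-(t * z / 2)) * Real.exp (t * |x|) := by
      rw [← Real.exp_add]
      apply Real.exp_le_exp.2
      nlinarith
    have h4 : x ^ 2 = 8 / t ^ 2 * ((t * |x| / 2) ^ 2 / 2) := by
      rw [div_pow (t * |x|), mul_pow t, sq_abs]; field_simp; norm_num
    rw [h4, mul_assoc]
    refine mul_le_mul_of_nonneg_left (h2.trans (h3.trans ?_)) (by positivity)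
    exact mul_le_mul_of_nonneg_left h1 (Real.exp_pos _).le
  have hmeas : MeasurableSet {ω | z < |inner ℝ ψ (ξ ω)|} :=
    measurableSet_lt measurable_const (by fun_prop)
  calc ∫ ω, {ω | z < |inner ℝ ψ (ξ ω)|}.indicator (fun ω => (inner ℝ ψ (ξ ω)) ^ 2) ω ∂P
      ≤ ∫ ω, (8 / t ^ 2 * Real.exp (-(t * z / 2))) *
          (Real.exp (t * inner ℝ ψ (ξ ω)) + Real.exp (-t * inner ℝ ψ (ξ ω))) ∂P := by
        refine integral_mono ((h.integrable_sq hξ hc hσ hψ).1.indicator hmeas)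
          ((hi1.add hi2).const_mul _) fun ω => ?_
        by_cases hω : z < |inner ℝ ψ (ξ ω)|
        · rw [Set.indicator_of_mem (by exact hω)]
          exact hpt _ hω
        · rw [Set.indicator_of_notMem (by exact hω)]
          positivity
    _ = (8 / t ^ 2 * Real.exp (-(t * z / 2))) * ((∫ ω, Real.exp (t * inner ℝ ψ (ξ ω)) ∂P)
          + ∫ ω, Real.exp (-t * inner ℝ ψ (ξ ω)) ∂P) := by
        rw [integral_const_mul, integral_add hi1 hi2]
    -- Since `σ²t² ≤ 1/4`, the two Laplace transforms add up to at most 3; then `8/t² * 3 = 96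
    -- (c+σ)²`.
    _ ≤ (8 / t ^ 2 * Real.exp (-(t * z / 2))) * 3 := by
        refine mul_le_mul_of_nonneg_left ?_ (by positivity)
        rw [neg_sq] at hb2
        have h3 : σ ^ 2 * t ^ 2 ≤ 1 / 4 := by
          have : 0 ≤ t * σ := by positivity
          nlinarith
        have h4 := Real.abs_exp_sub_one_sub_id_le (x := σ ^ 2 * t ^ 2)
          (by rw [abs_of_nonneg (by positivity)]; linarith)
        have h5 := (le_abs_self _).trans h4
        have h6 : 0 ≤ σ ^ 2 * t ^ 2 := by positivity
        nlinarith
    _ ≤ 100 * (c + σ) ^ 2 * Real.exp (-(z / (4 * (c + σ)))) := by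
        have h1 : 8 / t ^ 2 = 32 * (c + σ) ^ 2 := by
          rw [ht]; field_simp; norm_num
        have h2 : t * z / 2 = z / (4 * (c + σ)) := by
          rw [ht]; field_simp; norm_num [mul_comm]
        rw [h1, h2]
        have : 0 ≤ (c + σ) ^ 2 * Real.exp (-(z / (4 * (c + σ)))) := by positivity
        nlinarith

/-! ### Nets and deviation of the projected noise. -/

/-- A set of vectors of norm `2` has a `1`-net of at most `5 ^ dim` of its points. -/
theorem exists_finset_net {E : Type*} [NormedAddCommGroup E] [NormedSpace ℝ E]
    [FiniteDimensional ℝ E] (A : Set E) (hA : ∀ x ∈ A, ‖x‖ = 2) :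
    ∃ T : Finset E, (∀ x ∈ T, x ∈ A) ∧ T.card ≤ 5 ^ Module.finrank ℝ E ∧
      ∀ w ∈ A, ∃ x ∈ T, ‖w - x‖ < 1 := by
  classical
  -- A 1-separated subset of maximal cardinality is a net; volume comparison bounds that
  -- cardinality.
  let Q : ℕ → Prop := fun k => ∃ T : Finset E, (∀ x ∈ T, x ∈ A) ∧
    (∀ x ∈ T, ∀ y ∈ T, x ≠ y → 1 ≤ ‖x - y‖) ∧ T.card = k
  have hbound : ∀ k, Q k → k ≤ 5 ^ Module.finrank ℝ E := by
    rintro k ⟨T, hTA, hsep, rfl⟩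
    exact Besicovitch.card_le_of_separated T (fun x hx => (hA x (hTA x hx)).le) hsep
  have h0 : Q 0 := ⟨∅, by simp, by simp, rfl⟩
  have hmax := Nat.findGreatest_spec (P := Q) (Nat.zero_le (5 ^ Module.finrank ℝ E)) h0
  obtain ⟨T, hTA, hsep, hcard⟩ := hmax
  refine ⟨T, hTA, ?_, fun w hw => ?_⟩
  · rw [hcard]; exact Nat.findGreatest_le _
  · by_contra! hcon
    have hwT : w ∉ T := fun hwT => by
      have := hcon w hwT
      rw [sub_self, norm_zero] at this
      linarith
    have hQ : Q (T.card + 1) := by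
      refine ⟨insert w T, ?_, ?_, Finset.card_insert_of_notMem hwT⟩
      · intro x hx
        rcases Finset.mem_insert.1 hx with rfl | hx
        exacts [hw, hTA x hx]
      · intro x hx y hy hxy
        rcases Finset.mem_insert.1 hx with hx | hx <;>
          rcases Finset.mem_insert.1 hy with hy | hy
        · exact absurd (hx.trans hy.symm) hxy
        · rw [hx]; exact hcon y hy
        · rw [hy, norm_sub_rev]; exact hcon x hx
        · exact hsep x hx y hy hxy
    have := Nat.le_findGreatest (hbound _ hQ) hQ
    omega

/-- Deviation inequality for the norm of the projection of `ξ`, as long as this projection has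
small coordinates. -/
theorem LaplaceBound.measure_norm_starProjection_ge_le [IsProbabilityMeasure P]
    (h : LaplaceBound P ξ σ c)
    (hc : 0 < c) (hσ : 0 < σ) (S : Submodule ℝ (EuclideanSpace ℝ (Fin n))) {r u : ℝ}
    (hr : 0 < r) (hu : 0 ≤ u) :
    P.real {ω | r ≤ ‖S.starProjection (ξ ω)‖ ∧ ∀ i, |S.starProjection (ξ ω) i| ≤ u}
      ≤ Real.exp (2 * Module.finrank ℝ S - 3 / 16 * (r ^ 2 / (σ ^ 2 + u * c))) := by
  classical
  set q := σ ^ 2 + u * c with hq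
  have hq0 : 0 < q := by positivity
  have huq : u * c ≤ q := by rw [hq]; nlinarith [sq_nonneg σ]
  have hσq : σ ^ 2 ≤ q := by rw [hq]; nlinarith [mul_nonneg hu hc.le]
  obtain ⟨T, hTA, hTcard, hT⟩ := exists_finset_net
    {x : S | ‖x‖ = 2 ∧ ∀ i, |(x : EuclideanSpace ℝ (Fin n)) i| ≤ 2 * u / r} (fun x hx => hx.1)
  have hsub : {ω | r ≤ ‖S.starProjection (ξ ω)‖ ∧ ∀ i, |S.starProjection (ξ ω) i| ≤ u}
      ⊆ ⋃ x ∈ T, {ω | 7 / 4 * r ≤ inner ℝ (x : EuclideanSpace ℝ (Fin n)) (ξ ω)} := by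
    rintro ω ⟨h1, h2⟩
    set w := S.starProjection (ξ ω) with hw
    have hwS : w ∈ S := Submodule.starProjection_apply_mem _ _
    have hw0 : 0 < ‖w‖ := hr.trans_le h1
    let w' : S := (2 / ‖w‖) • ⟨w, hwS⟩
    have hw'n : ‖w'‖ = 2 := by
      simp only [w', norm_smul, norm_div, norm_norm, Real.norm_ofNat]
      exact div_mul_cancel₀ _ hw0.ne'
    obtain ⟨x, hxT, hx⟩ := hT w' ⟨hw'n, fun i => by
      simp only [w', Submodule.coe_smul, PiLp.smul_apply, smul_eq_mul, abs_mul, abs_div, abs_norm,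
        abs_two]
      rw [div_mul_eq_mul_div]
      have := h2 i
      gcongr⟩
    have hxn := (hTA x hxT).1
    -- Both vectors have norm 2, so `8 - 2⟪w', x⟫ = ‖w' - x‖² < 1`.
    have hin : 7 / 2 ≤ inner ℝ w' x := by
      have := norm_sub_sq_real w' x
      rw [hw'n, hxn] at this
      have h3 : ‖w' - x‖ ^ 2 < 1 := by
        have := norm_nonneg (w' - x); nlinarith
      linarith
    simp only [Set.mem_iUnion]
    refine ⟨x, hxT, ?_⟩
    have h4 : inner ℝ (x : EuclideanSpace ℝ (Fin n)) (ξ ω)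
        = inner ℝ (x : EuclideanSpace ℝ (Fin n)) w := by
      rw [hw, ← Submodule.inner_starProjection_left_eq_right,
        Submodule.starProjection_eq_self_iff.2 x.2]
    have h5 : inner ℝ w' x = 2 / ‖w‖ * inner ℝ (x : EuclideanSpace ℝ (Fin n)) w := by
      rw [Submodule.coe_inner, real_inner_comm, Submodule.coe_smul, inner_smul_right]
    change 7 / 4 * r ≤ _
    rw [h4]
    rw [h5, div_mul_eq_mul_div, le_div_iff₀ hw0] at hin
    nlinarith
  have hone : ∀ x ∈ T, P.real {ω | 7 / 4 * r ≤ inner ℝ (x : EuclideanSpace ℝ (Fin n)) (ξ ω)}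
      ≤ Real.exp (- (3 / 16 * (r ^ 2 / q))) := by
    intro x hx
    obtain ⟨hxn, hxi⟩ := hTA x hx
    -- This `t` meets the coordinate constraint because `uc ≤ q`, and gives the exponent `-7/16 +
    -- 4/16 = -3/16` in units of `r²/q`.
    set t := r / (4 * q) with ht
    have ht0 : 0 < t := by positivity
    obtain ⟨hi, hb⟩ := h (t • (x : EuclideanSpace ℝ (Fin n))) (fun i => by
      rw [PiLp.smul_apply, smul_eq_mul, abs_mul, abs_of_pos ht0]
      calc t * |(x : EuclideanSpace ℝ (Fin n)) i| * c ≤ t * (2 * u / r) * c := by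
            gcongr; exact hxi i
        _ = (u * c) / (2 * q) := by rw [ht]; field_simp; norm_num
        _ ≤ 1 / 2 := by rw [div_le_div_iff₀ (by positivity) (by norm_num)]; linarith)
    simp only [inner_smul_left, conj_trivial] at hi hb
    have hch := measure_ge_le_exp_mul_mgf (μ := P)
      (X := fun ω => inner ℝ (x : EuclideanSpace ℝ (Fin n)) (ξ ω)) (7 / 4 * r) ht0.le hi
    refine hch.trans ((mul_le_mul_of_nonneg_left hb (Real.exp_pos _).le).trans ?_)
    rw [← Real.exp_add, norm_smul, Real.norm_of_nonneg ht0.le, ← Submodule.coe_norm, hxn]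
    apply Real.exp_le_exp.2
    have h1 : σ ^ 2 * (t * 2) ^ 2 ≤ q * (t * 2) ^ 2 := by gcongr
    have h2 : -t * (7 / 4 * r) + q * (t * 2) ^ 2 = -(3 / 16 * (r ^ 2 / q)) := by
      rw [ht]; field_simp; norm_num
    linarith
  calc P.real {ω | r ≤ ‖S.starProjection (ξ ω)‖ ∧ ∀ i, |S.starProjection (ξ ω) i| ≤ u}
      ≤ P.real (⋃ x ∈ T, {ω | 7 / 4 * r ≤ inner ℝ (x : EuclideanSpace ℝ (Fin n)) (ξ ω)}) :=
        measureReal_mono hsub (measure_ne_top _ _)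
    _ ≤ ∑ x ∈ T, P.real {ω | 7 / 4 * r ≤ inner ℝ (x : EuclideanSpace ℝ (Fin n)) (ξ ω)} :=
        measureReal_biUnion_finset_le _ _
    _ ≤ T.card * Real.exp (- (3 / 16 * (r ^ 2 / q))) := by
        rw [← nsmul_eq_mul]; exact Finset.sum_le_card_nsmul _ _ _ hone
    _ ≤ Real.exp (2 * Module.finrank ℝ S) * Real.exp (- (3 / 16 * (r ^ 2 / q))) := by
        refine mul_le_mul_of_nonneg_right ?_ (Real.exp_pos _).le
        have h5 : (5 : ℝ) ≤ Real.exp 2 := by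
          have := Real.exp_one_gt_d9
          rw [show (2 : ℝ) = 1 + 1 by norm_num, Real.exp_add]
          nlinarith
        calc (T.card : ℝ) ≤ 5 ^ Module.finrank ℝ S := by exact_mod_cast hTcard
          _ ≤ Real.exp 2 ^ Module.finrank ℝ S := by gcongr
          _ = Real.exp (2 * Module.finrank ℝ S) := by rw [← Real.exp_nat_mul, mul_comm]
    _ = _ := by rw [← Real.exp_add]; rfl

/-- Integration of an exponential tail. -/
theorem integral_le_of_exp_tail [IsProbabilityMeasure P] {X : Ω → ℝ} (hX : Measurable X)
    (h0 : ∀ ω, 0 ≤ X ω) {C s : ℝ}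
    (hC : 0 ≤ C) (hs : 0 < s) (h : ∀ t > 0, P.real {ω | t < X ω} ≤ C * Real.exp (-(t / s))) :
    ∫ ω, X ω ∂P ≤ C * s := by
  have hint : IntegrableOn (fun t : ℝ => C * Real.exp (-s⁻¹ * t)) (Set.Ioi 0) :=
    (integrableOn_exp_mul_Ioi (by simpa using hs) 0).const_mul C
  rw [integral_eq_lintegral_of_nonneg_ae (Filter.Eventually.of_forall h0) hX.aestronglyMeasurable]
  refine ENNReal.toReal_le_of_le_ofReal (by positivity) ?_
  rw [lintegral_eq_lintegral_meas_lt P (Filter.Eventually.of_forall h0) hX.aemeasurable]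
  calc ∫⁻ t in Set.Ioi 0, P {ω | t < X ω}
      ≤ ∫⁻ t in Set.Ioi (0 : ℝ), ENNReal.ofReal (C * Real.exp (-s⁻¹ * t)) := by
        refine setLIntegral_mono' measurableSet_Ioi fun t ht => ?_
        rw [← ofReal_measureReal]
        refine ENNReal.ofReal_le_ofReal ((h t ht).trans_eq ?_)
        congr 2
        rw [div_eq_inv_mul, neg_mul]
    _ = ENNReal.ofReal (C * s) := by
        rw [← ofReal_integral_eq_lintegral_ofReal hint
          (Filter.Eventually.of_forall fun t => by positivity), integral_const_mul,
          integral_exp_mul_Ioi (by simpa using hs)]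
        congr 1
        simp

end LaplaceBound

/-! ### Projections in orthonormal coordinates. -/

section Orthonormal

variable {n : ℕ} {ι : Type*} {ψ : ι → EuclideanSpace ℝ (Fin n)}

theorem starProjection_eq_sum (hψ : Orthonormal ℝ ψ) {I : Finset ι}
    {S : Submodule ℝ (EuclideanSpace ℝ (Fin n))} (hS : S = Submodule.span ℝ (ψ '' I))
    (y : EuclideanSpace ℝ (Fin n)) :
    S.starProjection y = ∑ k ∈ I, inner ℝ (ψ k) y • ψ k := by
  subst hS
  refine Submodule.eq_starProjection_of_mem_of_inner_eq_zero ?_ ?_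
  · exact Submodule.sum_mem _ fun k hk =>
      Submodule.smul_mem _ _ (Submodule.subset_span ⟨k, hk, rfl⟩)
  · intro w hw
    induction hw using Submodule.span_induction with
    | mem x hx =>
      obtain ⟨l, hl, rfl⟩ := hx
      rw [real_inner_comm, inner_sub_right, hψ.inner_right_sum _ (by exact hl), sub_self]
    | zero => simp
    | add x y _ _ hx hy => rw [inner_add_right, hx, hy, add_zero]
    | smul a x _ hx => rw [inner_smul_right, hx, mul_zero]

theorem norm_sq_sum_smul (hψ : Orthonormal ℝ ψ) (I : Finset ι) (a : ι → ℝ) :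
    ‖∑ k ∈ I, a k • ψ k‖ ^ 2 = ∑ k ∈ I, a k ^ 2 := by
  rw [← real_inner_self_eq_norm_sq, hψ.inner_sum]
  exact Finset.sum_congr rfl fun k _ => by simp [sq]

theorem norm_sq_sub_sum_smul (hψ : Orthonormal ℝ ψ) (I : Finset ι) (a : ι → ℝ)
    (y : EuclideanSpace ℝ (Fin n)) :
    ‖y - ∑ k ∈ I, a k • ψ k‖ ^ 2
      = ‖y‖ ^ 2 - 2 * ∑ k ∈ I, a k * inner ℝ (ψ k) y + ∑ k ∈ I, a k ^ 2 := by
  rw [norm_sub_sq_real, norm_sq_sum_smul hψ, inner_sum]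
  simp only [inner_smul_right, real_inner_comm]

theorem finrank_span_image (hψ : Orthonormal ℝ ψ) (I : Finset ι) :
    Module.finrank ℝ (Submodule.span ℝ (ψ '' I)) = I.card := by
  have h := finrank_span_eq_card (hψ.linearIndependent.comp ((↑) : I → ι) Subtype.val_injective)
  rw [Set.range_comp, Subtype.range_coe_subtype] at h
  simpa using h

theorem abs_starProjection_le (hψ : Orthonormal ℝ ψ) {I : Finset ι}
    {S : Submodule ℝ (EuclideanSpace ℝ (Fin n))} (hS : S = Submodule.span ℝ (ψ '' I)) {B z : ℝ}
    (hB : ∀ k i, |ψ k i| ≤ B) {y : EuclideanSpace ℝ (Fin n)}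
    (hz : ∀ k, |inner ℝ (ψ k) y| ≤ z) (i : Fin n) :
    |S.starProjection y i| ≤ I.card * (z * B) := by
  rw [starProjection_eq_sum hψ hS, WithLp.ofLp_sum, Finset.sum_apply, ← nsmul_eq_mul]
  refine (Finset.abs_sum_le_sum_abs _ _).trans (Finset.sum_le_card_nsmul _ _ _ fun k _ => ?_)
  rw [PiLp.smul_apply, smul_eq_mul, abs_mul]
  exact mul_le_mul (hz k) (hB k i) (abs_nonneg _) ((abs_nonneg _).trans (hz k))

end Orthonormal

/-! ### Risk of the selected model. -/

section Selection

variable {Ω : Type*} [MeasurableSpace Ω] {P : Measure Ω} [IsProbabilityMeasure P]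

/-- A centered variable of variance at most `4σ²` has a small correlation with the indicator of an
event, relative to the probabilities of the event and of its complement. -/
theorem two_mul_integral_indicator_le {X : Ω → ℝ} (hX : Integrable X P)
    (hX2 : Integrable (fun ω => X ω ^ 2) P) (h0 : ∫ ω, X ω ∂P = 0) {σ : ℝ}
    (hσ : ∫ ω, X ω ^ 2 ∂P ≤ 4 * σ ^ 2) {B : Set Ω} (hB : MeasurableSet B) (β : ℝ) {K : ℝ}
    (hK : 0 < K) :
    2 * (β * ∫ ω, B.indicator X ω ∂P) ≤ β ^ 2 * (1 - P.real B) / K + 4 * K * σ ^ 2 * P.real B := by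
  rcases (measureReal_nonneg (μ := P) (s := B)).eq_or_lt with hp | hp
  · have hB0 : P B = 0 := by
      rwa [eq_comm, measureReal_eq_zero_iff] at hp
    rw [integral_indicator hB, Measure.restrict_eq_zero.2 hB0, integral_zero_measure, ← hp]
    simp only [mul_zero, sub_zero, mul_one, add_zero]
    positivity
  set p := P.real B with hpdef
  set t : Ω → ℝ := B.indicator 1 with ht
  have ht01 : ∀ ω, t ω = 0 ∨ t ω = 1 := fun ω => by
    by_cases h : ω ∈ B <;> simp [ht, h]
  have htI : Integrable t P := (integrable_const (1 : ℝ)).indicator hB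
  have htp : ∫ ω, t ω ∂P = p := by rw [ht, integral_indicator_one hB]
  have htX : ∀ ω, B.indicator X ω = t ω * X ω := fun ω => by
    by_cases h : ω ∈ B <;> simp [ht, h]
  have htXI : Integrable (fun ω => t ω * X ω) P :=
    (hX.indicator hB).congr (Filter.Eventually.of_forall htX)
  have hs : 0 < K * p := by positivity
  -- Young's inequality for `β (t - p)` and `X` with weight `K p`. Centering the indicator is free
  -- since `X` has mean 0, and its variance `p(1 - p)` cancels the `p` in the denominator.
  have hpt : ∀ ω, 2 * β * (t ω * X ω) - 2 * β * p * X ω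
      ≤ β ^ 2 / (K * p) * ((1 - 2 * p) * t ω + p ^ 2) + K * p * X ω ^ 2 := by
    intro ω
    have h1 : (1 - 2 * p) * t ω + p ^ 2 = (t ω - p) ^ 2 := by
      rcases ht01 ω with h | h <;> rw [h] <;> ring
    have h2 : β ^ 2 / (K * p) * (t ω - p) ^ 2 + K * p * X ω ^ 2
        - (2 * β * (t ω * X ω) - 2 * β * p * X ω)
        = (β * (t ω - p) - K * p * X ω) ^ 2 / (K * p) := by
      field_simp
      ring
    rw [h1]
    have : 0 ≤ (β * (t ω - p) - K * p * X ω) ^ 2 / (K * p) := by positivity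
    linarith
  have hint := integral_mono ((htXI.const_mul (2 * β)).sub (hX.const_mul (2 * β * p)))
    ((((htI.const_mul (1 - 2 * p)).add (integrable_const (p ^ 2))).const_mul
      (β ^ 2 / (K * p))).add (hX2.const_mul (K * p))) hpt
  have e := integral_add (((htI.const_mul (1 - 2 * p)).add (integrable_const (p ^ 2))).const_mul
      (β ^ 2 / (K * p))) (hX2.const_mul (K * p))
  simp only [Pi.sub_apply, Pi.add_apply] at hint e
  rw [integral_sub (htXI.const_mul (2 * β)) (hX.const_mul (2 * β * p)), e] at hint
  simp only [integral_const_mul] at hint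
  rw [integral_add (htI.const_mul (1 - 2 * p)) (integrable_const (p ^ 2)), integral_const_mul,
    h0, htp] at hint
  simp only [integral_const, probReal_univ, smul_eq_mul, one_mul, mul_zero, sub_zero] at hint
  simp_rw [htX]
  have h3 : β ^ 2 / (K * p) * ((1 - 2 * p) * p + p ^ 2) = β ^ 2 * (1 - p) / K := by
    field_simp
    ring
  rw [h3] at hint
  nlinarith [mul_le_mul_of_nonneg_left hσ hs.le]

/-- Model selection in a sequence model with correlated noise `X`: the risk of the selected model is
bounded by penalized risks, up to the integral of any variable `W` through which the penalty
dominates the noise in all models. -/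
theorem selected_risk_le {ι : Type*} [Fintype ι] {X : ι → Ω → ℝ}
    (hX : ∀ k, Integrable (X k) P) (hX2 : ∀ k, Integrable (fun ω => X k ω ^ 2) P)
    (h0 : ∀ k, ∫ ω, X k ω ∂P = 0) {σ : ℝ} (hσ : ∀ k, ∫ ω, X k ω ^ 2 ∂P ≤ 4 * σ ^ 2)
    (β : ι → ℝ) {F2 : ℝ} (hF2 : ∑ k, β k ^ 2 ≤ F2) {α : Type*} (I : α → Finset ι)
    (M : Finset α) (pen : α → ℝ) {K : ℝ} (hK : 0 < K) {W : Ω → ℝ} (hW : Integrable W P)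
    (hpen : ∀ ω, ∀ m ∈ M,
      2 * ∑ k ∈ I m, X k ω ^ 2 ≤ pen m - 4 * K * σ ^ 2 * (I m).card + W ω)
    (mhat : Ω → α) (hmeas : ∀ m ∈ M, MeasurableSet {ω | mhat ω = m}) (hmem : ∀ ω, mhat ω ∈ M)
    (hmin : ∀ ω, ∀ m ∈ M, -∑ k ∈ I (mhat ω), (β k + X k ω) ^ 2 + pen (mhat ω)
      ≤ -∑ k ∈ I m, (β k + X k ω) ^ 2 + pen m) :
    Integrable (fun ω => F2 - ∑ k ∈ I (mhat ω), β k ^ 2 + ∑ k ∈ I (mhat ω), X k ω ^ 2) P ∧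
    (∀ m, Integrable (fun ω => F2 - ∑ k ∈ I m, β k ^ 2 + ∑ k ∈ I m, X k ω ^ 2) P) ∧
    ∀ m ∈ M, (1 - 1 / K) *
        ∫ ω, (F2 - ∑ k ∈ I (mhat ω), β k ^ 2 + ∑ k ∈ I (mhat ω), X k ω ^ 2) ∂P
      ≤ ∫ ω, (F2 - ∑ k ∈ I m, β k ^ 2 + ∑ k ∈ I m, X k ω ^ 2) ∂P + pen m + ∫ ω, W ω ∂P := by
  classical
  set B : ι → Set Ω := fun k => {ω | k ∈ I (mhat ω)} with hBdef
  have hB : ∀ k, MeasurableSet (B k) := by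
    intro k
    have : B k = ⋃ m ∈ M.filter (fun m => k ∈ I m), {ω | mhat ω = m} := by
      ext ω
      simp only [hBdef, Set.mem_iUnion, Finset.mem_filter, Set.mem_ofPred_eq, exists_prop]
      exact ⟨fun h => ⟨mhat ω, ⟨hmem ω, h⟩, rfl⟩, by rintro ⟨m, ⟨-, h⟩, rfl⟩; exact h⟩
    rw [this]
    exact Finset.measurableSet_biUnion _ fun m hm => hmeas m (Finset.mem_filter.1 hm).1
  have hsum : ∀ (g : ι → Ω → ℝ) (ω : Ω),
      ∑ k ∈ I (mhat ω), g k ω = ∑ k, (B k).indicator (g k) ω := by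
    intro g ω
    rw [← Finset.sum_filter_add_sum_filter_not Finset.univ (fun k => k ∈ I (mhat ω))]
    rw [Finset.sum_eq_zero (s := Finset.univ.filter fun k => k ∉ I (mhat ω)), add_zero]
    · refine Finset.sum_congr (by ext; simp) fun k hk => ?_
      exact (Set.indicator_of_mem (s := B k) (by simpa [hBdef] using hk) _).symm
    · intro k hk
      exact Set.indicator_of_notMem (s := B k) (by simpa [hBdef] using hk) _
  have hcB : ∀ (k : ι) (b : ℝ), Integrable ((B k).indicator fun _ => b) P :=
    fun k b => (integrable_const b).indicator (hB k)
  have hI2 : Integrable (fun ω => ∑ k ∈ I (mhat ω), X k ω ^ 2) P := by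
    simp_rw [hsum (fun k ω => X k ω ^ 2)]
    exact integrable_finsetSum _ fun k _ => (hX2 k).indicator (hB k)
  have hIβ : Integrable (fun ω => ∑ k ∈ I (mhat ω), β k ^ 2) P := by
    simp_rw [hsum (fun k _ => β k ^ 2)]
    exact integrable_finsetSum _ fun k _ => hcB k _
  have hA : Integrable
      (fun ω => F2 - ∑ k ∈ I (mhat ω), β k ^ 2 + ∑ k ∈ I (mhat ω), X k ω ^ 2) P :=
    ((integrable_const F2).sub hIβ).add hI2
  have hAm : ∀ m, Integrable
      (fun ω => F2 - ∑ k ∈ I m, β k ^ 2 + ∑ k ∈ I m, X k ω ^ 2) P :=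
    fun m => (integrable_const _).add (integrable_finsetSum _ fun k _ => hX2 k)
  refine ⟨hA, hAm, fun m hm => ?_⟩
  set A : Ω → ℝ := fun ω => F2 - ∑ k ∈ I (mhat ω), β k ^ 2 + ∑ k ∈ I (mhat ω), X k ω ^ 2 with hAdef
  set Am : Ω → ℝ := fun ω => F2 - ∑ k ∈ I m, β k ^ 2 + ∑ k ∈ I m, X k ω ^ 2 with hAmdef
  -- the pointwise comparison
  have hpt : ∀ ω, A ω ≤ Am ω - 2 * ∑ k ∈ I m, β k * X k ω + pen m + W ω
      + ∑ k, (2 * (β k * (B k).indicator (X k) ω)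
        - 4 * K * σ ^ 2 * (B k).indicator (fun _ => (1 : ℝ)) ω) := by
    intro ω
    have h1 := hmin ω m hm
    have h2 := hpen ω (mhat ω) (hmem ω)
    have h3 : ∀ J : Finset ι, ∑ k ∈ J, (β k + X k ω) ^ 2
        = ∑ k ∈ J, β k ^ 2 + 2 * ∑ k ∈ J, β k * X k ω + ∑ k ∈ J, X k ω ^ 2 := by
      intro J
      rw [Finset.mul_sum, ← Finset.sum_add_distrib, ← Finset.sum_add_distrib]
      exact Finset.sum_congr rfl fun k _ => by ring
    rw [h3, h3] at h1
    have h4 : ∑ k, (2 * (β k * (B k).indicator (X k) ω)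
        - 4 * K * σ ^ 2 * (B k).indicator (fun _ => (1 : ℝ)) ω)
        = 2 * ∑ k ∈ I (mhat ω), β k * X k ω - 4 * K * σ ^ 2 * (I (mhat ω)).card := by
      rw [Finset.sum_sub_distrib, ← Finset.mul_sum, ← Finset.mul_sum, ← hsum (fun _ _ => (1 : ℝ)),
        hsum (fun k ω => β k * X k ω), Finset.sum_const, nsmul_one]
      congr 2
      refine Finset.sum_congr rfl fun k _ => ?_
      by_cases h : ω ∈ B k <;> simp [h]
    rw [h4]
    have h5 : 0 ≤ ∑ k ∈ I m, X k ω ^ 2 := Finset.sum_nonneg fun k _ => sq_nonneg _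
    simp only [hAdef, hAmdef]
    linarith
  have hS : Integrable (fun ω => ∑ k ∈ I m, β k * X k ω) P :=
    integrable_finsetSum _ fun k _ => (hX k).const_mul _
  have hT1 : ∀ k, Integrable (fun ω => 2 * (β k * (B k).indicator (X k) ω)) P :=
    fun k => (((hX k).indicator (hB k)).const_mul _).const_mul _
  have hT2 : ∀ k, Integrable
      (fun ω => 4 * K * σ ^ 2 * (B k).indicator (fun _ => (1 : ℝ)) ω) P :=
    fun k => (hcB k 1).const_mul _
  have hT : Integrable (fun ω => ∑ k, (2 * (β k * (B k).indicator (X k) ω)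
        - 4 * K * σ ^ 2 * (B k).indicator (fun _ => (1 : ℝ)) ω)) P :=
    integrable_finsetSum _ fun k _ => (hT1 k).sub (hT2 k)
  have hS0 : ∫ ω, ∑ k ∈ I m, β k * X k ω ∂P = 0 := by
    rw [integral_finsetSum _ fun k _ => (hX k).const_mul _]
    simp [integral_const_mul, h0]
  have h1B : ∀ k, ∫ ω, (B k).indicator (fun _ => (1 : ℝ)) ω ∂P = P.real (B k) :=
    fun k => integral_indicator_one (hB k)
  have hTint : ∫ ω, ∑ k, (2 * (β k * (B k).indicator (X k) ω)
        - 4 * K * σ ^ 2 * (B k).indicator (fun _ => (1 : ℝ)) ω) ∂P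
        ≤ ∑ k, β k ^ 2 * (1 - P.real (B k)) / K := by
    have e := integral_finsetSum Finset.univ fun k _ => (hT1 k).sub (hT2 k)
    simp only [Pi.sub_apply] at e
    rw [e]
    refine Finset.sum_le_sum fun k _ => ?_
    rw [integral_sub (hT1 k) (hT2 k), integral_const_mul, integral_const_mul, integral_const_mul,
      h1B]
    have := two_mul_integral_indicator_le (hX k) (hX2 k) (h0 k) (hσ k) (hB k) (β k) hK
    linarith
  -- the approximation error of the selected model
  have hbias : ∑ k, β k ^ 2 * (1 - P.real (B k)) / K ≤ 1 / K * ∫ ω, A ω ∂P := by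
    rw [← Finset.sum_div, div_eq_inv_mul, one_div]
    refine mul_le_mul_of_nonneg_left ?_ (by positivity)
    have h6 : ∫ ω, (F2 - ∑ k ∈ I (mhat ω), β k ^ 2) ∂P
        = F2 - ∑ k, β k ^ 2 * P.real (B k) := by
      rw [integral_sub (integrable_const F2) hIβ]
      simp_rw [hsum (fun k _ => β k ^ 2)]
      rw [integral_finsetSum _ fun k _ => hcB k _]
      simp only [integral_const, probReal_univ, smul_eq_mul, one_mul, integral_indicator (hB _),
        measureReal_restrict_apply MeasurableSet.univ, Set.univ_inter]
      congr 1
      exact Finset.sum_congr rfl fun k _ => mul_comm _ _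
    have h7 : ∫ ω, (F2 - ∑ k ∈ I (mhat ω), β k ^ 2) ∂P ≤ ∫ ω, A ω ∂P := by
      refine integral_mono ((integrable_const F2).sub hIβ) hA fun ω => ?_
      simp only [hAdef]
      have : 0 ≤ ∑ k ∈ I (mhat ω), X k ω ^ 2 := Finset.sum_nonneg fun k _ => sq_nonneg _
      linarith
    simp only [mul_sub, mul_one, Finset.sum_sub_distrib]
    linarith
  have hfin := integral_mono hA
    (((((hAm m).sub (hS.const_mul 2)).add (integrable_const (pen m))).add hW).add hT) hpt
  simp only [Pi.add_apply, Pi.sub_apply] at hfin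
  have e1 := integral_add ((((hAm m).sub (hS.const_mul 2)).add (integrable_const (pen m))).add hW) hT
  have e2 := integral_add (((hAm m).sub (hS.const_mul 2)).add (integrable_const (pen m))) hW
  have e3 := integral_add ((hAm m).sub (hS.const_mul 2)) (integrable_const (μ := P) (pen m))
  have e4 := integral_sub (hAm m) (hS.const_mul 2)
  simp only [Pi.add_apply, Pi.sub_apply] at e1 e2 e3 e4
  rw [e1, e2, e3, e4, integral_const_mul, hS0] at hfin
  simp only [integral_const, probReal_univ, smul_eq_mul, one_mul, mul_zero, sub_zero] at hfin
  rw [sub_mul, one_mul]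
  linarith

/-- The mean excess of the noise in a model over its penalty, on an event on which the projected
noise has small coordinates. -/
theorem LaplaceBound.integral_excess_le {n : ℕ} {ξ : Ω → EuclideanSpace ℝ (Fin n)} {σ c : ℝ}
    (h : LaplaceBound P ξ σ c) (hξ : Measurable ξ) (hc : 0 < c) (hσ : 0 < σ)
    (S : Submodule ℝ (EuclideanSpace ℝ (Fin n))) {u V Δ : ℝ} (hu : 0 ≤ u) (hΔ : 0 ≤ Δ)
    (hV : σ ^ 2 + u * c ≤ 12 * V) {G : Set Ω} (hG : MeasurableSet G)
    (hGu : ∀ ω ∈ G, ∀ i, |S.starProjection (ξ ω) i| ≤ u) :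
    ∫ ω, G.indicator (fun ω => max (‖S.starProjection (ξ ω)‖ ^ 2
        - 160 * V * (Module.finrank ℝ S + Δ)) 0) ω ∂P ≤ 160 * V * Real.exp (-Δ) := by
  have hq : 0 < σ ^ 2 + u * c := by positivity
  have hV0 : 0 < V := by linarith
  rw [mul_comm (160 * V) (Real.exp (-Δ))]
  refine integral_le_of_exp_tail (Measurable.indicator (by fun_prop) hG)
    (fun ω => Set.indicator_nonneg (fun _ _ => le_max_right _ _) _) (Real.exp_pos _).le
    (by positivity) fun t ht => ?_
  set D : ℝ := (Module.finrank ℝ S : ℝ) with hD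
  have hD0 : 0 ≤ D := Nat.cast_nonneg _
  have hr2 : 0 < 160 * V * (D + Δ) + t := by positivity
  have hsub : {ω | t < G.indicator (fun ω => max (‖S.starProjection (ξ ω)‖ ^ 2
        - 160 * V * (D + Δ)) 0) ω}
      ⊆ {ω | √(160 * V * (D + Δ) + t) ≤ ‖S.starProjection (ξ ω)‖ ∧
        ∀ i, |S.starProjection (ξ ω) i| ≤ u} := by
    intro ω hω
    have hω' : t < G.indicator (fun ω => max (‖S.starProjection (ξ ω)‖ ^ 2
        - 160 * V * (D + Δ)) 0) ω := hω
    have hωG : ω ∈ G := by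
      by_contra hn
      rw [Set.indicator_of_notMem hn] at hω'
      linarith
    rw [Set.indicator_of_mem hωG, lt_max_iff] at hω'
    refine ⟨?_, hGu ω hωG⟩
    rw [Real.sqrt_le_left (norm_nonneg _)]
    rcases hω' with h1 | h1 <;> linarith
  refine (measureReal_mono hsub (measure_ne_top _ _)).trans
    ((h.measure_norm_starProjection_ge_le hc hσ S (Real.sqrt_pos.2 hr2) hu).trans ?_)
  rw [← Real.exp_add, Real.sq_sqrt hr2.le]
  apply Real.exp_le_exp.2
  have h1 : (160 * V * (D + Δ) + t) / (12 * V) ≤ (160 * V * (D + Δ) + t) / (σ ^ 2 + u * c) := by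
    gcongr
  -- As `3/16 * 160/12 = 5/2 ≥ 2`, the level absorbs the entropy term `2D` and still leaves
  -- `exp(-Δ)`.
  have h2 : 3 / 16 * ((160 * V * (D + Δ) + t) / (12 * V)) = 5 / 2 * (D + Δ) + t / (64 * V) := by
    field_simp
    ring
  have h3 : t / (160 * V) ≤ t / (64 * V) := by
    gcongr
    norm_num
  linarith

end Selection

/-! ### Truncation error and numerical constants. -/

/-- If the largest of finitely many numbers exceeds a level, the sum of their squares is controlled
by the squares of those above the level. -/
theorem sum_sq_le_card_mul_sum_of_exists_lt {ι : Type*} [Fintype ι] (x : ι → ℝ) {z : ℝ}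
    (h : ∃ k, z < |x k|) :
    ∑ k, x k ^ 2 ≤ Fintype.card ι * ∑ k, if z < |x k| then x k ^ 2 else 0 := by
  obtain ⟨k₀, hk₀⟩ := h
  obtain ⟨j, -, hj⟩ := Finset.exists_max_image Finset.univ (fun k => |x k|) ⟨k₀, Finset.mem_univ _⟩
  have hzj : z < |x j| := hk₀.trans_le (hj k₀ (Finset.mem_univ _))
  have h1 : x j ^ 2 ≤ ∑ k, if z < |x k| then x k ^ 2 else 0 := by
    have := Finset.single_le_sum (f := fun k => if z < |x k| then x k ^ 2 else 0)
      (fun k _ => by split_ifs <;> positivity) (Finset.mem_univ j)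
    simpa [hzj] using this
  calc ∑ k, x k ^ 2 ≤ ∑ _k : ι, x j ^ 2 :=
        Finset.sum_le_sum fun k hk => sq_le_sq.2 (hj k hk)
    _ = Fintype.card ι * x j ^ 2 := by simp
    _ ≤ _ := by gcongr

theorem LaplaceBound.integral_sum_sq_indicator_le {Ω : Type*} [MeasurableSpace Ω] {P : Measure Ω}
    [IsProbabilityMeasure P] {n : ℕ} {ξ : Ω → EuclideanSpace ℝ (Fin n)} {σ c : ℝ}
    (h : LaplaceBound P ξ σ c) (hξ : Measurable ξ) (hc : 0 < c) (hσ : 0 < σ) {ι : Type*}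
    [Fintype ι] {ψ : ι → EuclideanSpace ℝ (Fin n)} (hψ : ∀ k, ‖ψ k‖ = 1) (z : ℝ) :
    ∫ ω, {ω | ∃ k, z < |inner ℝ (ψ k) (ξ ω)|}.indicator
        (fun ω => ∑ k, inner ℝ (ψ k) (ξ ω) ^ 2) ω ∂P
      ≤ (Fintype.card ι : ℝ) ^ 2 * (100 * (c + σ) ^ 2 * Real.exp (-(z / (4 * (c + σ))))) := by
  have hB : ∀ k, MeasurableSet {ω | z < |inner ℝ (ψ k) (ξ ω)|} := fun k =>
    measurableSet_lt measurable_const (by fun_prop)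
  have hG : MeasurableSet {ω | ∃ k, z < |inner ℝ (ψ k) (ξ ω)|} := by
    have : {ω | ∃ k, z < |inner ℝ (ψ k) (ξ ω)|} = ⋃ k, {ω | z < |inner ℝ (ψ k) (ξ ω)|} := by
      ext ω; simp
    rw [this]
    exact MeasurableSet.iUnion hB
  have hint : ∀ k, Integrable ({ω | z < |inner ℝ (ψ k) (ξ ω)|}.indicator
      fun ω => inner ℝ (ψ k) (ξ ω) ^ 2) P :=
    fun k => (h.integrable_sq hξ hc hσ (hψ k)).1.indicator (hB k)
  calc ∫ ω, {ω | ∃ k, z < |inner ℝ (ψ k) (ξ ω)|}.indicator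
        (fun ω => ∑ k, inner ℝ (ψ k) (ξ ω) ^ 2) ω ∂P
      ≤ ∫ ω, Fintype.card ι * ∑ k, {ω | z < |inner ℝ (ψ k) (ξ ω)|}.indicator
          (fun ω => inner ℝ (ψ k) (ξ ω) ^ 2) ω ∂P := by
        refine integral_mono ((integrable_finsetSum _ fun k _ =>
          (h.integrable_sq hξ hc hσ (hψ k)).1).indicator hG)
          ((integrable_finsetSum _ fun k _ => hint k).const_mul _) fun ω => ?_
        by_cases hω : ∃ k, z < |inner ℝ (ψ k) (ξ ω)|
        · rw [Set.indicator_of_mem (by exact hω)]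
          refine (sum_sq_le_card_mul_sum_of_exists_lt _ hω).trans_eq ?_
          congr 1
        · rw [Set.indicator_of_notMem (by exact hω)]
          exact mul_nonneg (Nat.cast_nonneg _) (Finset.sum_nonneg fun k _ =>
            Set.indicator_nonneg (fun _ _ => sq_nonneg _) _)
    _ = Fintype.card ι * ∑ k, ∫ ω, {ω | z < |inner ℝ (ψ k) (ξ ω)|}.indicator
          (fun ω => inner ℝ (ψ k) (ξ ω) ^ 2) ω ∂P := by
        rw [integral_const_mul, integral_finsetSum _ fun k _ => hint k]
    _ ≤ Fintype.card ι * ∑ _k : ι, (100 * (c + σ) ^ 2 * Real.exp (-(z / (4 * (c + σ))))) := by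
        gcongr with k
        exact h.integral_sq_indicator_le hξ hc hσ (hψ k) z
    _ = _ := by
        rw [Finset.sum_const, Finset.card_univ, nsmul_eq_mul]
        ring

theorem half_lt_log {n : ℕ} (hn : 2 ≤ n) : 1 / 2 < Real.log n := by
  have h1 : Real.log 2 ≤ Real.log n :=
    Real.log_le_log (by norm_num) (by exact_mod_cast hn)
  linarith [Real.log_two_gt_d9]

/-- The `log n` in the truncation level cancels the one in the dimension bound; `√2` is rounded up
to 2. -/
theorem card_mul_level_le {n : ℕ} (hn : 2 ≤ n) {a b c σ d N : ℝ} (ha : 0 < a) (hb : 0 < b)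
    (hc : 0 < c) (hσ : 0 < σ) (hdN : d ≤ N) (hN : N ≤ √n / (a * Real.log n)) :
    d * (24 * (c + σ) * (b + 2) * Real.log n * √(2 / n)) ≤ 48 * (c + σ) * (b + 2) / a := by
  have hL : 0 < Real.log n := by linarith [half_lt_log hn]
  have hn0 : (0 : ℝ) < n := by exact_mod_cast (by omega : 0 < n)
  have hs : 0 < √(n : ℝ) := Real.sqrt_pos.2 hn0
  have h2 : √(2 / n : ℝ) ≤ 2 / √n := by
    rw [Real.sqrt_div (by norm_num)]
    gcongr
    rw [Real.sqrt_le_left (by norm_num)]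
    norm_num
  calc d * (24 * (c + σ) * (b + 2) * Real.log n * √(2 / n))
      ≤ √n / (a * Real.log n) * (24 * (c + σ) * (b + 2) * Real.log n * (2 / √n)) := by
        gcongr
        exact hdN.trans hN
    _ = 48 * (c + σ) * (b + 2) / a := by
        field_simp
        norm_num

/-- With `e = n^{-(b+2)}` the exponential is `e ^ 6`. Using `d ≤ n` and `d ≤ N` once each gives
`d²a²N ≤ 4n²`; one factor `e` cancels `n^{b+2}`, and `e ≤ 1/4` makes the other five beat the
constant 800. -/
theorem truncation_error_le {n : ℕ} (hn : 2 ≤ n) {a b c σ d N : ℝ} (ha : 0 < a) (hb : 0 < b)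
    (hc : 0 < c) (hσ : 0 < σ) (hd0 : 0 ≤ d) (hdn : d ≤ n) (hdN : d ≤ N) (hN0 : 0 < N)
    (hN : N ≤ √n / (a * Real.log n)) :
    2 * (d ^ 2 * (100 * (c + σ) ^ 2 *
        Real.exp (-(24 * (c + σ) * (b + 2) * Real.log n / (4 * (c + σ))))))
      ≤ 4 * (b + 2) ^ 2 * (c + σ) ^ 2 / (a ^ 2 * N * (n : ℝ) ^ b) := by
  have hL2 := half_lt_log hn
  set L := Real.log n with hL
  have hn0 : (0 : ℝ) < n := by exact_mod_cast (by omega : 0 < n)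
  have hn2 : (2 : ℝ) ≤ n := by exact_mod_cast hn
  have hN2 : a ^ 2 * N ^ 2 ≤ 4 * n := by
    rw [le_div_iff₀ (by positivity)] at hN
    have h1 : (N * (a * L)) ^ 2 ≤ √(n : ℝ) ^ 2 := by gcongr
    rw [Real.sq_sqrt hn0.le] at h1
    have h2 : a ^ 2 * N ^ 2 * (1 / 2) ^ 2 ≤ a ^ 2 * N ^ 2 * L ^ 2 := by gcongr
    nlinarith
  have hd : d ^ 2 * (a ^ 2 * N) ≤ 4 * (n : ℝ) ^ 2 := by
    calc d ^ 2 * (a ^ 2 * N) = d * d * (a ^ 2 * N) := by ring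
      _ ≤ n * N * (a ^ 2 * N) := by gcongr
      _ = n * (a ^ 2 * N ^ 2) := by ring
      _ ≤ n * (4 * n) := by gcongr
      _ = 4 * (n : ℝ) ^ 2 := by ring
  set e := Real.exp (-((b + 2) * L)) with he
  have he0 : 0 < e := Real.exp_pos _
  have hexp : Real.exp (-(24 * (c + σ) * (b + 2) * L / (4 * (c + σ)))) = e ^ 6 := by
    rw [he, ← Real.exp_nat_mul]
    congr 1
    field_simp
    norm_num
  have hne : (n : ℝ) ^ 2 * (n : ℝ) ^ b * e = 1 := by
    have h1 : Real.exp L = n := Real.exp_log hn0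
    rw [Real.rpow_def_of_pos hn0, ← hL, he]
    nth_rewrite 1 [← h1]
    rw [← Real.exp_nat_mul, ← Real.exp_add, ← Real.exp_add, Real.exp_eq_one_iff]
    push_cast
    ring
  have he4 : e ≤ 1 / 4 := by
    have h1 : (1 : ℝ) ≤ (n : ℝ) ^ b := Real.one_le_rpow (by linarith) hb.le
    have h2 : 4 * e ≤ (n : ℝ) ^ 2 * (n : ℝ) ^ b * e := by
      have : (4 : ℝ) * 1 ≤ (n : ℝ) ^ 2 * (n : ℝ) ^ b := by gcongr; nlinarith
      nlinarith
    linarith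
  have hnb : 0 < (n : ℝ) ^ b := Real.rpow_pos_of_pos hn0 b
  rw [hexp, le_div_iff₀ (by positivity)]
  calc 2 * (d ^ 2 * (100 * (c + σ) ^ 2 * e ^ 6)) * (a ^ 2 * N * (n : ℝ) ^ b)
      = 200 * (c + σ) ^ 2 * e ^ 6 * (n : ℝ) ^ b * (d ^ 2 * (a ^ 2 * N)) := by ring
    _ ≤ 200 * (c + σ) ^ 2 * e ^ 6 * (n : ℝ) ^ b * (4 * (n : ℝ) ^ 2) := by gcongr
    _ = 800 * (c + σ) ^ 2 * e ^ 5 * ((n : ℝ) ^ 2 * (n : ℝ) ^ b * e) := by ring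
    _ = 800 * (c + σ) ^ 2 * e ^ 5 := by rw [hne, mul_one]
    _ ≤ 800 * (c + σ) ^ 2 * (1 / 4) ^ 5 := by gcongr
    _ ≤ 4 * 2 ^ 2 * (c + σ) ^ 2 := by nlinarith [sq_nonneg (c + σ)]
    _ ≤ 4 * (b + 2) ^ 2 * (c + σ) ^ 2 := by gcongr; linarith

/-- Where `κ = 18` is used: `4K + 320 ≤ 324K = κ²K` for `K ≥ 1`. -/
theorem noise_level_le_penalty_level {K V v d Δ : ℝ} (hK : 1 ≤ K) (hV : 0 ≤ V) (hv : v ≤ V)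
    (hd : 0 ≤ d) (hΔ : 0 ≤ Δ) :
    4 * K * v * d + 320 * V * (d + Δ) ≤ K * 18 ^ 2 * V * (d + Δ) ∧ 0 ≤ 320 * V * (d + Δ) := by
  have h1 : K * v * d ≤ K * V * (d + Δ) := by
    calc K * v * d ≤ K * V * d := by gcongr
      _ ≤ K * V * (d + Δ) := by gcongr; linarith
  have h2 : V * (d + Δ) ≤ K * (V * (d + Δ)) := le_mul_of_one_le_left (by positivity) hK
  exact ⟨by linarith, by positivity⟩

/-- The argument yields the constant `K/(K-1)`, which is below `CK K` because `(K-1)² ≤ K² + K - 1`.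
-/
theorem le_CK_mul {K x T : ℝ} (hK : 1 < K) (hx : 0 ≤ x) (h : (1 - 1 / K) * x ≤ T) :
    x ≤ CK K * T := by
  have hK1 : 0 < K - 1 := by linarith
  have hK0 : 0 < K := by linarith
  have hCK : K / (K - 1) ≤ CK K := by
    rw [CK, div_le_div_iff₀ hK1 (by positivity), pow_succ (K - 1) 2, ← mul_assoc]
    refine mul_le_mul_of_nonneg_right (mul_le_mul_of_nonneg_left ?_ hK0.le) hK1.le
    nlinarith
  have h1 : (1 - 1 / K) * x = (K - 1) / K * x := by
    congr 1
    field_simp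
  rw [h1] at h
  have h2 : 0 ≤ (K - 1) / K * x := by positivity
  calc x = K / (K - 1) * ((K - 1) / K * x) := by field_simp
    _ ≤ K / (K - 1) * T := mul_le_mul_of_nonneg_left h (by positivity)
    _ ≤ CK K * T := mul_le_mul_of_nonneg_right hCK (h2.trans h)

end TrigSelection

end

/-! ### Assembly of the oracle inequality. -/

theorem proposition3p3 {Ω : Type*} [MeasurableSpace Ω] (P : Measure Ω) [IsProbabilityMeasure P]
    (n : ℕ) (hn : 2 ≤ n) (σ c : ℝ) (hσ : 0 < σ) (hc : 0 < c)
    (F : ℝ → ℝ) (Y : Ω → EuclideanSpace ℝ (Fin n)) (hY : Measurable Y)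
    (hindep : iIndepFun (fun (i : Fin n) (ω : Ω) => Y ω i) P)
    (hint : ∀ i : Fin n, Integrable (fun ω => Y ω i) P)
    (hmean : ∀ i : Fin n, ∫ ω, Y ω i ∂P = TrigSelection.regressionMean n F i)
    (hbern : ∀ i : Fin n, TrigSelection.BernsteinCondition P
      (fun ω => Y ω i - TrigSelection.regressionMean n F i) σ c)
    (Dbar : ℕ) (M : Finset (Finset ℕ)) (hM : M.Nonempty)
    (hMsub : ∀ m ∈ M, ∀ j ∈ m, j ≤ 2 * Dbar)
    (Δ : Finset ℕ → ℝ) (hΔ : ∀ m ∈ M, 0 ≤ Δ m)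
    (a b : ℝ) (ha : 0 < a) (hb : 0 < b)
    (hD : 2 * (Dbar : ℝ) + 1 ≤ Real.sqrt n / (a * Real.log n))
    (K : ℝ) (hK : 1 < K) (pen : Finset ℕ → ℝ)
    (hpen : ∀ m ∈ M, K * TrigSelection.kappa ^ 2 * TrigSelection.varianceFactor σ c a b
      * ((TrigSelection.modelDim n m : ℝ) + Δ m) ≤ pen m)
    (mhat : Ω → Finset ℕ) (hmhat_meas : ∀ m ∈ M, MeasurableSet {ω | mhat ω = m})
    (hmhat_mem : ∀ ω, mhat ω ∈ M)
    (hmhat_min : ∀ ω, ∀ m ∈ M,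
      TrigSelection.crit n pen (Y ω) (mhat ω) ≤ TrigSelection.crit n pen (Y ω) m) :
    Integrable (fun ω => ‖TrigSelection.regressionMean n F
        - TrigSelection.leastSquares n (mhat ω) (Y ω)‖ ^ 2) P ∧
    (∀ m ∈ M, Integrable (fun ω => ‖TrigSelection.regressionMean n F
        - TrigSelection.leastSquares n m (Y ω)‖ ^ 2) P) ∧
    ∫ ω, ‖TrigSelection.regressionMean n F
        - TrigSelection.leastSquares n (mhat ω) (Y ω)‖ ^ 2 ∂P
      ≤ TrigSelection.CK K *
        (M.inf' hM (fun m => ∫ ω, ‖TrigSelection.regressionMean n F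
            - TrigSelection.leastSquares n m (Y ω)‖ ^ 2 ∂P + pen m)
          + TrigSelection.remainder n Dbar M Δ σ c a b) := by
  classical
  have hn0 : n ≠ 0 := by omega
  set f := TrigSelection.regressionMean n F with hf
  set ξ : Ω → EuclideanSpace ℝ (Fin n) := fun ω => Y ω - f with hξdef
  have hξ : Measurable ξ := hY.sub_const f
  have hYξ : ∀ ω, Y ω = f + ξ ω := fun ω => by simp [hξdef]
  have hLap : TrigSelection.LaplaceBound P ξ σ c :=
    TrigSelection.laplaceBound_of_bernstein hξ hc
      (hindep.comp (fun i x => x - f i) fun i => measurable_id.sub_const _) hbern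
  obtain ⟨s, ψ, hsN, hψ, hψi, hI⟩ := TrigSelection.exists_orthonormal_trigModel hn0 (2 * Dbar + 1)
  have hI' : ∀ m ∈ M, ∃ I : Finset s,
      TrigSelection.trigModel n m = Submodule.span ℝ (ψ '' I) := fun m hm =>
    hI m fun j hj => Finset.mem_range.2 (by have := hMsub m hm j hj; omega)
  choose! I hIm using hI'
  set X : s → Ω → ℝ := fun k ω => inner ℝ (ψ k) (ξ ω) with hX
  set β : s → ℝ := fun k => inner ℝ (ψ k) f with hβ
  have hψ1 : ∀ k, ‖ψ k‖ = 1 := hψ.1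
  have hX2 := fun k => hLap.integrable_sq hξ hc hσ (hψ1 k)
  have hξi : ∀ i, Integrable (fun ω => ξ ω i) P := fun i => (hint i).sub (integrable_const _)
  have hXeq : ∀ k ω, X k ω = ∑ i, ψ k i * ξ ω i := fun k ω => by
    simp [hX, PiLp.inner_apply, mul_comm]
  have hXint : ∀ k, Integrable (X k) P := fun k => by
    rw [show X k = fun ω => ∑ i, ψ k i * ξ ω i from funext (hXeq k)]
    exact integrable_finsetSum _ fun i _ => (hξi i).const_mul _
  have hX0 : ∀ k, ∫ ω, X k ω ∂P = 0 := fun k => by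
    simp_rw [hXeq]
    rw [integral_finsetSum _ fun i _ => (hξi i).const_mul _]
    refine Finset.sum_eq_zero fun i _ => ?_
    have : ∫ ω, ξ ω i ∂P = 0 := by
      have e := integral_sub (hint i) (integrable_const (μ := P) (f i))
      rw [hmean i] at e
      simpa [hξdef] using e
    rw [integral_const_mul, this, mul_zero]
  -- risk and criterion in coordinates
  have hls : ∀ m ∈ M, ∀ y, TrigSelection.leastSquares n m y
      = ∑ k ∈ I m, inner ℝ (ψ k) y • ψ k := fun m hm y => by
    rw [TrigSelection.leastSquares, TrigSelection.starProjection_eq_sum hψ (hIm m hm)]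
  have hYk : ∀ k ω, inner ℝ (ψ k) (Y ω) = β k + X k ω := fun k ω => by
    rw [hYξ, inner_add_right]
  have hrisk : ∀ m ∈ M, ∀ ω, ‖f - TrigSelection.leastSquares n m (Y ω)‖ ^ 2
      = ‖f‖ ^ 2 - ∑ k ∈ I m, β k ^ 2 + ∑ k ∈ I m, X k ω ^ 2 := fun m hm ω => by
    rw [hls m hm, TrigSelection.norm_sq_sub_sum_smul hψ, Finset.mul_sum, sub_add,
      ← Finset.sum_sub_distrib, sub_add, ← Finset.sum_sub_distrib]
    congr 1
    refine Finset.sum_congr rfl fun k _ => ?_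
    rw [hYk]
    ring
  have hcrit : ∀ m ∈ M, ∀ ω, TrigSelection.crit n pen (Y ω) m
      = ‖Y ω‖ ^ 2 + (-∑ k ∈ I m, (β k + X k ω) ^ 2 + pen m) := fun m hm ω => by
    rw [TrigSelection.crit, hls m hm, TrigSelection.norm_sq_sub_sum_smul hψ]
    simp only [← hYk, ← sq]
    ring
  have hdim : ∀ m ∈ M, TrigSelection.modelDim n m = (I m).card := fun m hm => by
    rw [TrigSelection.modelDim, hIm m hm, TrigSelection.finrank_span_image hψ]
  have hproj : ∀ m ∈ M, ∀ ω, ‖(TrigSelection.trigModel n m).starProjection (ξ ω)‖ ^ 2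
      = ∑ k ∈ I m, X k ω ^ 2 := fun m hm ω => by
    rw [TrigSelection.starProjection_eq_sum hψ (hIm m hm), TrigSelection.norm_sq_sum_smul hψ]
  -- the event on which all coordinates of the noise are small
  have hL := TrigSelection.half_lt_log hn
  set V := TrigSelection.varianceFactor σ c a b with hV
  -- The level `z` is chosen so that `u`, the resulting coordinate bound for projections, does not
  -- involve `n` and `uc` is 12 times the second term of `V`.
  set z := 24 * (c + σ) * (b + 2) * Real.log n with hz
  set u := 48 * (c + σ) * (b + 2) / a with hu
  have hz0 : 0 ≤ z := by positivity
  have hu0 : 0 ≤ u := by positivity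
  have hσV : σ ^ 2 ≤ V := by
    rw [hV, TrigSelection.varianceFactor]
    have : 0 ≤ 4 * c * (c + σ) * (b + 2) / a := by positivity
    linarith
  have hV0 : 0 < V := lt_of_lt_of_le (by positivity) hσV
  have huV : σ ^ 2 + u * c ≤ 12 * V := by
    have : u * c = 12 * (4 * c * (c + σ) * (b + 2) / a) := by rw [hu]; ring
    rw [this, hV, TrigSelection.varianceFactor]
    nlinarith [sq_nonneg σ]
  set G : Set Ω := {ω | ∃ k, z < |X k ω|}ᶜ with hG
  have hGm : MeasurableSet G := by
    have : {ω | ∃ k, z < |X k ω|} = ⋃ k, {ω | z < |X k ω|} := by ext ω; simp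
    rw [hG, this]
    exact (MeasurableSet.iUnion fun k =>
      measurableSet_lt measurable_const (by fun_prop)).compl
  have hcardN : ∀ J : Finset s, (J.card : ℝ) ≤ 2 * (Dbar : ℝ) + 1 := fun J => by
    have h1 : J.card ≤ 2 * Dbar + 1 := (Finset.card_le_univ J).trans (by simpa using hsN)
    exact_mod_cast h1
  have hGu : ∀ m ∈ M, ∀ ω ∈ G, ∀ i,
      |(TrigSelection.trigModel n m).starProjection (ξ ω) i| ≤ u := by
    intro m hm ω hω i
    have hω' : ∀ k, |inner ℝ (ψ k) (ξ ω)| ≤ z := fun k => by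
      by_contra hk
      exact hω ⟨k, not_le.1 hk⟩
    exact (TrigSelection.abs_starProjection_le hψ (hIm m hm) hψi hω' i).trans
      (TrigSelection.card_mul_level_le hn ha hb hc hσ (hcardN _) hD)
  -- the excess of the noise over the penalty
  set E : Finset ℕ → Ω → ℝ := fun m => G.indicator fun ω =>
    max (‖(TrigSelection.trigModel n m).starProjection (ξ ω)‖ ^ 2
      - 160 * V * (Module.finrank ℝ (TrigSelection.trigModel n m) + Δ m)) 0 with hE
  have hEint : ∀ m ∈ M, Integrable (E m) P := fun m hm => by
    refine Integrable.indicator (Integrable.sup ?_ (integrable_const 0)) hGm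
    simp_rw [hproj m hm]
    exact (integrable_finsetSum _ fun k _ => (hX2 k).1).sub (integrable_const _)
  have hE0 : ∀ m ω, 0 ≤ E m ω := fun m ω =>
    Set.indicator_nonneg (fun _ _ => le_max_right _ _) _
  set T : Ω → ℝ := Gᶜ.indicator fun ω => ∑ k, X k ω ^ 2 with hT
  have hTint : Integrable T P :=
    (integrable_finsetSum _ fun k _ => (hX2 k).1).indicator hGm.compl
  have hT0 : ∀ ω, 0 ≤ T ω := fun ω =>
    Set.indicator_nonneg (fun _ _ => Finset.sum_nonneg fun k _ => sq_nonneg _) _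
  -- Summing the excesses over `M` makes the bound uniform in the selected model; `T` replaces them
  -- where some coordinate exceeds `z`.
  set W : Ω → ℝ := fun ω => ∑ m ∈ M, 2 * E m ω + 2 * T ω with hW
  have hEsum : Integrable (fun ω => ∑ m ∈ M, 2 * E m ω) P :=
    integrable_finsetSum _ fun m hm => (hEint m hm).const_mul 2
  have hWint : Integrable W P := hEsum.add (hTint.const_mul 2)
  have hWR : ∫ ω, W ω ∂P ≤ TrigSelection.remainder n Dbar M Δ σ c a b := by
    have e1 := integral_add hEsum (hTint.const_mul 2)
    rw [integral_finsetSum _ fun m hm => (hEint m hm).const_mul 2] at e1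
    simp only [integral_const_mul] at e1
    have h1 : ∑ m ∈ M, 2 * ∫ ω, E m ω ∂P
        ≤ TrigSelection.kappa ^ 2 * V * ∑ m ∈ M, Real.exp (-Δ m) := by
      rw [Finset.mul_sum]
      refine Finset.sum_le_sum fun m hm => ?_
      have := hLap.integral_excess_le hξ hc hσ (TrigSelection.trigModel n m) hu0 (hΔ m hm) huV hGm
        (hGu m hm)
      have h3 : 0 < V * Real.exp (-Δ m) := by positivity
      rw [TrigSelection.kappa]
      linarith
    have h2 : 2 * ∫ ω, T ω ∂P ≤ 4 * (b + 2) ^ 2 * (c + σ) ^ 2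
        / (a ^ 2 * (2 * (Dbar : ℝ) + 1) * (n : ℝ) ^ b) := by
      have h3 := hLap.integral_sum_sq_indicator_le hξ hc hσ hψ1 z
      have h4 : Gᶜ = {ω | ∃ k, z < |inner ℝ (ψ k) (ξ ω)|} := by rw [hG, compl_compl]
      rw [← h4] at h3
      refine (mul_le_mul_of_nonneg_left h3 zero_le_two).trans ?_
      -- Holds even under aliasing, since `ψ` is linearly independent in dimension `n`.
      have hcn : Fintype.card s ≤ n := by
        simpa using hψ.linearIndependent.fintype_card_le_finrank
      exact TrigSelection.truncation_error_le hn ha hb hc hσ (Nat.cast_nonneg _)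
        (by exact_mod_cast hcn) (hcardN Finset.univ) (by positivity) hD
    rw [TrigSelection.remainder]
    exact e1.trans_le (add_le_add h1 h2)
  have hpenW : ∀ ω, ∀ m ∈ M, 2 * ∑ k ∈ I m, X k ω ^ 2
      ≤ pen m - 4 * K * σ ^ 2 * (I m).card + W ω := by
    intro ω m hm
    have hΔm := hΔ m hm
    have hp := hpen m hm
    rw [hdim m hm, TrigSelection.kappa] at hp
    have hEm : 2 * E m ω ≤ ∑ m ∈ M, 2 * E m ω :=
      Finset.single_le_sum (f := fun m => 2 * E m ω)
        (fun m _ => mul_nonneg zero_le_two (hE0 m ω)) hm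
    have hd : (0 : ℝ) ≤ (I m).card := Nat.cast_nonneg _
    obtain ⟨h1, h2⟩ := TrigSelection.noise_level_le_penalty_level hK.le hV0.le hσV hd hΔm
    have h4 := hE0 m ω
    have h5 := hT0 ω
    simp only [hW]
    by_cases hω : ω ∈ G
    · have h6 : ‖(TrigSelection.trigModel n m).starProjection (ξ ω)‖ ^ 2
          - 160 * V * (Module.finrank ℝ (TrigSelection.trigModel n m) + Δ m) ≤ E m ω := by
        simp only [hE]
        rw [Set.indicator_of_mem hω]
        exact le_max_left _ _
      rw [hproj m hm, show Module.finrank ℝ (TrigSelection.trigModel n m) = (I m).card from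
        hdim m hm] at h6
      linarith
    · have h6 : ∑ k ∈ I m, X k ω ^ 2 ≤ T ω := by
        simp only [hT]
        rw [Set.indicator_of_mem (by exact hω)]
        exact Finset.sum_le_sum_of_subset_of_nonneg (Finset.subset_univ _)
          fun k _ _ => sq_nonneg _
      linarith
  -- Bessel's inequality; the part of `f` outside the span of `ψ` is a bias common to all models.
  have hF2 : ∑ k, β k ^ 2 ≤ ‖f‖ ^ 2 := by
    have := hψ.sum_inner_products_le (x := f) (s := Finset.univ)
    simpa using this
  obtain ⟨hA, hAm, hle⟩ := TrigSelection.selected_risk_le hXint (fun k => (hX2 k).1) hX0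
    (fun k => (hX2 k).2) β hF2 I M pen (zero_lt_one.trans hK) hWint hpenW mhat hmhat_meas hmhat_mem
    (fun ω m hm => by
      have := hmhat_min ω m hm
      rw [hcrit m hm, hcrit _ (hmhat_mem ω)] at this
      exact le_of_add_le_add_left this)
  have hriskhat : ∀ ω, ‖f - TrigSelection.leastSquares n (mhat ω) (Y ω)‖ ^ 2
      = ‖f‖ ^ 2 - ∑ k ∈ I (mhat ω), β k ^ 2 + ∑ k ∈ I (mhat ω), X k ω ^ 2 :=
    fun ω => hrisk _ (hmhat_mem ω) ω
  simp only [← hriskhat] at hA hle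
  refine ⟨hA, fun m hm => by simpa only [hrisk m hm] using hAm m, ?_⟩
  set x := ∫ ω, ‖f - TrigSelection.leastSquares n (mhat ω) (Y ω)‖ ^ 2 ∂P with hx
  have hx0 : 0 ≤ x := integral_nonneg fun ω => by positivity
  set R := TrigSelection.remainder n Dbar M Δ σ c a b with hR
  set O := M.inf' hM (fun m => ∫ ω, ‖f - TrigSelection.leastSquares n m (Y ω)‖ ^ 2 ∂P + pen m)
    with hO
  have hinf : (1 - 1 / K) * x - R ≤ O := by
    refine Finset.le_inf' _ _ fun m hm => ?_
    have := hle m hm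
    simp only [← hrisk m hm] at this
    linarith
  exact TrigSelection.le_CK_mul hK hx0 (by linarith)
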